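/- Let $r\simeq 0.834$ and $s\simeq 0.651$ be the roots, in $[0.834,0.835]$ and $[0.651,0.652]$ respectively, of $$4r^8-36r^7-27r^6+162r^5+135r^4-88r^3-73r^2-14r+1,$$ $$89s^8+1344s^7+4008s^6-464s^5-2410s^4+176s^3+296s^2-96s+1.$$ **Tight triangles.** For $x,y,z\in\{1,r,s\}$, the tight triangle $xyz$ is the triangle whose vertices are the centers of three mutually tangent circles of radii $x,y,z$ (so its sides are $x+y$, $y+z$, $z+x$). Let $\mathrm{area}(xyz)$ be its area, $\mathrm{cov}(xyz)$ the area of the part of it that is inside the three circles, and let $\check\alpha_{xqy}$ denote the angle of the tight triangle with circles $x,q,y$ at the center of the circle of radius $q$. Let $$\delta=\frac{4\,\mathrm{cov}(1rs)+\mathrm{cov}(11s)+\mathrm{cov}(1rr)}{4\,\mathrm{area}(1rs)+\mathrm{area}(11s)+\mathrm{area}(1rr)}\simeq 0.9093$$ (the density of the compact packing by circles of radii $1,r,s$, a primitive cell of which consists of four triangles $1rs$, one triangle $11s$ and one triangle $1rr$) and $E(xyz)=\delta\,\mathrm{area}(xyz)-\mathrm{cov}(xyz)$. Let $V_{xqy}=V_{yqx}$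 ($x,q,y\in\{1,r,s\}$) be the unique solution of the linear system consisting of $V_{yxz}+V_{xyz}+V_{xzy}=E(xyz)$ for all $x,y,z$; $V_{xqx}=0$ for all $x\ne q$; and $$V_{1s1}+4V_{1sr}=0,\qquad 2V_{1rr}+4V_{1rs}=0,\qquad V_{r1r}+2V_{11s}+4V_{r1s}=0.$$ **Packings and FM-triangulations.** A packing is a set of interior-disjoint circles of the plane, each of radius $1$, $r$ or $s$; it is saturated if no further circle of radius $s$ can be added. The cell of a circle $C$ with center $c$ and radius $\rho$ is the set of points $p$ for which $|p-c|-\rho\le |p-c'|-\rho'$ for every circle of the packing with center $c'$ and radius $\rho'$. An FM-triangulation of the packing is a triangulation of the plane whose vertices are the centers of the circles and which is dual to the cells, i.e. the cells of the three circles centered at the vertices of any of its triangles have a common point. **Vertex potentials.** Let $m_1,m_r,m_s$ be real numbers. If $v$ is a vertex of a triangle $T$ of an FM-triangulation, $q$ is the radius of the circle centered at $v$ and $x,y$ are the radii of the circles centered at the two other vertices of $T$, the vertex potential of $v$ in $T$ is $$U_v(T)=V_{xqy}+m_q\,\bigl|\widehat v(T)-\check\alpha_{xqy}\bigr|,$$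 where $\widehat v(T)$ is the angle of $T$ at $v$. **Proposition.** Assume that $$m_1\ge 0.115610891330759,\qquad m_r\ge 0.023471932071104,\qquad m_s\ge 0.022750796636041.$$ Then for every saturated packing by circles of radii $1,r,s$, every FM-triangulation $\mathcal T$ of it and every vertex $v$ of $\mathcal T$, only finitely many triangles of $\mathcal T$ contain $v$ and $$\sum_{T\in\mathcal T,\ v\in T}U_v(T)\ \ge\ 0 .$$ -/

import Mathlib

namespace TernaryPacking

noncomputable section

/-! ### The three circle sizes -/

theorem existsUnique_midRadius : ∃! x : ℝ, x ∈ Set.Icc (0.834 : ℝ) 0.835 ∧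
    4 * x ^ 8 - 36 * x ^ 7 - 27 * x ^ 6 + 162 * x ^ 5 + 135 * x ^ 4 - 88 * x ^ 3 - 73 * x ^ 2
      - 14 * x + 1 = 0 := by
  obtain ⟨x, hx, h0⟩ : (0 : ℝ) ∈ (fun x : ℝ => 4 * x ^ 8 - 36 * x ^ 7 - 27 * x ^ 6 + 162 * x ^ 5
      + 135 * x ^ 4 - 88 * x ^ 3 - 73 * x ^ 2 - 14 * x + 1) '' Set.Icc (0.834 : ℝ) 0.835 := by
    apply intermediate_value_Icc (by norm_num)
    · fun_prop
    · constructor <;> norm_num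
  refine ⟨x, ⟨hx, h0⟩, ?_⟩
  rintro y ⟨hy, hy0⟩
  have hmono : StrictMonoOn (fun x : ℝ => 4 * x ^ 8 - 36 * x ^ 7 - 27 * x ^ 6 + 162 * x ^ 5
      + 135 * x ^ 4 - 88 * x ^ 3 - 73 * x ^ 2 - 14 * x + 1) (Set.Icc (0.834 : ℝ) 0.835) := by
    apply strictMonoOn_of_deriv_pos (convex_Icc _ _) (by fun_prop)
    intro z hz
    rw [interior_Icc] at hz
    have hd : HasDerivAt (fun x : ℝ => 4 * x ^ 8 - 36 * x ^ 7 - 27 * x ^ 6 + 162 * x ^ 5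
      + 135 * x ^ 4 - 88 * x ^ 3 - 73 * x ^ 2 - 14 * x + 1)
      (4 * (8 * z ^ 7) - 36 * (7 * z ^ 6) - 27 * (6 * z ^ 5) + 162 * (5 * z ^ 4)
        + 135 * (4 * z ^ 3) - 88 * (3 * z ^ 2) - 73 * (2 * z) - 14) z := by
      have hp := fun n : ℕ => hasDerivAt_pow n z
      have h := (((((((((hp 8).const_mul 4).sub ((hp 7).const_mul 36)).sub
        ((hp 6).const_mul 27)).add ((hp 5).const_mul 162)).add ((hp 4).const_mul 135)).sub
        ((hp 3).const_mul 88)).sub ((hp 2).const_mul 73)).sub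
        ((hasDerivAt_id z).const_mul 14)).add_const 1
      exact h.congr_deriv (by norm_num)
    rw [hd.deriv]
    have hpow : ∀ n : ℕ, (0.834 : ℝ) ^ n ≤ z ^ n ∧ z ^ n ≤ (0.835 : ℝ) ^ n := fun n =>
      ⟨pow_le_pow_left₀ (by norm_num) hz.1.le n,
        pow_le_pow_left₀ (by linarith [hz.1]) hz.2.le n⟩
    have h7 := hpow 7; have h6 := hpow 6; have h5 := hpow 5; have h4 := hpow 4
    have h3 := hpow 3; have h2 := hpow 2; have h1 := hpow 1
    norm_num at h7 h6 h5 h4 h3 h2 h1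
    linarith [h7.1, h6.2, h5.2, h4.1, h3.1, h2.2, h1.2]
  exact hmono.injOn hy hx (hy0.trans h0.symm)

theorem existsUnique_smallRadius : ∃! x : ℝ, x ∈ Set.Icc (0.651 : ℝ) 0.652 ∧
    89 * x ^ 8 + 1344 * x ^ 7 + 4008 * x ^ 6 - 464 * x ^ 5 - 2410 * x ^ 4 + 176 * x ^ 3
      + 296 * x ^ 2 - 96 * x + 1 = 0 := by
  obtain ⟨x, hx, h0⟩ : (0 : ℝ) ∈ (fun x : ℝ => 89 * x ^ 8 + 1344 * x ^ 7 + 4008 * x ^ 6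
      - 464 * x ^ 5 - 2410 * x ^ 4 + 176 * x ^ 3 + 296 * x ^ 2 - 96 * x + 1) ''
      Set.Icc (0.651 : ℝ) 0.652 := by
    apply intermediate_value_Icc (by norm_num)
    · fun_prop
    · constructor <;> norm_num
  refine ⟨x, ⟨hx, h0⟩, ?_⟩
  rintro y ⟨hy, hy0⟩
  have hmono : StrictMonoOn (fun x : ℝ => 89 * x ^ 8 + 1344 * x ^ 7 + 4008 * x ^ 6
      - 464 * x ^ 5 - 2410 * x ^ 4 + 176 * x ^ 3 + 296 * x ^ 2 - 96 * x + 1)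
      (Set.Icc (0.651 : ℝ) 0.652) := by
    apply strictMonoOn_of_deriv_pos (convex_Icc _ _) (by fun_prop)
    intro z hz
    rw [interior_Icc] at hz
    have hd : HasDerivAt (fun x : ℝ => 89 * x ^ 8 + 1344 * x ^ 7 + 4008 * x ^ 6
      - 464 * x ^ 5 - 2410 * x ^ 4 + 176 * x ^ 3 + 296 * x ^ 2 - 96 * x + 1)
      (89 * (8 * z ^ 7) + 1344 * (7 * z ^ 6) + 4008 * (6 * z ^ 5) - 464 * (5 * z ^ 4)
        - 2410 * (4 * z ^ 3) + 176 * (3 * z ^ 2) + 296 * (2 * z) - 96) z := by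
      have hp := fun n : ℕ => hasDerivAt_pow n z
      have h := (((((((((hp 8).const_mul 89).add ((hp 7).const_mul 1344)).add
        ((hp 6).const_mul 4008)).sub ((hp 5).const_mul 464)).sub ((hp 4).const_mul 2410)).add
        ((hp 3).const_mul 176)).add ((hp 2).const_mul 296)).sub
        ((hasDerivAt_id z).const_mul 96)).add_const 1
      exact h.congr_deriv (by norm_num)
    rw [hd.deriv]
    have hpow : ∀ n : ℕ, (0.651 : ℝ) ^ n ≤ z ^ n ∧ z ^ n ≤ (0.652 : ℝ) ^ n := fun n =>
      ⟨pow_le_pow_left₀ (by norm_num) hz.1.le n,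
        pow_le_pow_left₀ (by linarith [hz.1]) hz.2.le n⟩
    have h7 := hpow 7; have h6 := hpow 6; have h5 := hpow 5; have h4 := hpow 4
    have h3 := hpow 3; have h2 := hpow 2; have h1 := hpow 1
    norm_num at h7 h6 h5 h4 h3 h2 h1
    linarith [h7.1, h6.1, h5.1, h4.2, h3.2, h2.1, h1.1]
  exact hmono.injOn hy hx (hy0.trans h0.symm)

/-- The radius `r ≃ 0.834`. -/
def midRadius : ℝ := existsUnique_midRadius.choose

/-- The radius `s ≃ 0.651`. -/
def smallRadius : ℝ := existsUnique_smallRadius.choose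

/-- The three possible sizes `1`, `r`, `s` of a circle. -/
inductive Size : Type
  | one
  | r
  | s

/-- The radius of a circle of given size. -/
def Size.radius : Size → ℝ
  | .one => 1
  | .r => midRadius
  | .s => smallRadius

theorem Size.radius_pos (x : Size) : 0 < x.radius := by
  cases x
  · exact one_pos
  · exact lt_of_lt_of_le (by norm_num) existsUnique_midRadius.choose_spec.1.1.1
  · exact lt_of_lt_of_le (by norm_num) existsUnique_smallRadius.choose_spec.1.1.1

/-! ### Tight triangles

A tight triangle joins the centers of three mutually tangent circles of radii `x`, `y`, `z`; its
side lengths are `x + y`, `y + z`, `z + x`. -/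

/-- The angle, at the center of the circle of size `q`, of the tight triangle with circles of sizes
`x`, `q`, `y` (law of cosines). -/
def tightAngle (x q y : Size) : ℝ :=
  Real.arccos (((q.radius + x.radius) ^ 2 + (q.radius + y.radius) ^ 2 - (x.radius + y.radius) ^ 2) /
    (2 * (q.radius + x.radius) * (q.radius + y.radius)))

/-- The area of the tight triangle with circles of sizes `x`, `y`, `z` (Heron's formula). -/
def tightArea (x y z : Size) : ℝ :=
  √((x.radius + y.radius + z.radius) * x.radius * y.radius * z.radius)

/-- The area of the part of a tight triangle which is inside its three circles: the sum of the
areas of the three circular sectors cut out by the angles of the triangle. -/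
def tightCov (x y z : Size) : ℝ :=
  tightAngle y x z / 2 * x.radius ^ 2 + tightAngle x y z / 2 * y.radius ^ 2 +
    tightAngle x z y / 2 * z.radius ^ 2

/-- The density `δ ≃ 0.9093` of the target packing. This packing is compact and periodic, and a
primitive cell of its triangulation consists of four tight triangles with circles of sizes
`1, r, s`, one with circles of sizes `1, 1, s` and one with circles of sizes `1, r, r`. -/
def targetDensity : ℝ :=
  (4 * tightCov .one .r .s + tightCov .one .one .s + tightCov .one .r .r) /
    (4 * tightArea .one .r .s + tightArea .one .one .s + tightArea .one .r .r)

/-- The excess `E(T) = δ area(T) - cov(T)` of a tight triangle. -/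
def tightExcess (x y z : Size) : ℝ :=
  targetDensity * tightArea x y z - tightCov x y z

/-- The system of equations that defines the potentials `V x q y` in the tight triangles, where
`V x q y` is the potential in the center of the circle of size `q` of the tight triangle with
circles of sizes `x`, `q`, `y`. -/
structure IsTightPotential (V : Size → Size → Size → ℝ) : Prop where
  symm : ∀ x q y, V x q y = V y q x
  /-- In each tight triangle, the potential equals the excess. -/
  sum_eq_excess : ∀ x y z, V y x z + V x y z + V x z y = tightExcess x y z
  /-- The potential vanishes at the apexes. -/
  apex : ∀ x q, x ≠ q → V x q x = 0
  /-- The potentials around a small circle of the target packing sum to zero. -/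
  corona_s : V .one .s .one + 4 * V .one .s .r = 0
  /-- The potentials around a medium circle of the target packing sum to zero. -/
  corona_r : 2 * V .one .r .r + 4 * V .one .r .s = 0
  /-- The potentials around a large circle of the target packing sum to zero. -/
  corona_one : V .r .one .r + 2 * V .one .one .s + 4 * V .r .one .s = 0

/-- The potentials in the tight triangles: the unique solution of the system `IsTightPotential`
(see `isTightPotential_iff`). -/
def tightPotential : Size → Size → Size → ℝ
  | .one, .one, .one => tightExcess .one .one .one / 3
  | .r, .r, .r => tightExcess .r .r .r / 3
  | .s, .s, .s => tightExcess .s .s .s / 3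
  | .r, .one, .r => 0
  | .s, .one, .s => 0
  | .one, .r, .one => 0
  | .s, .r, .s => 0
  | .one, .s, .one => 0
  | .r, .s, .r => 0
  | .one, .one, .r => tightExcess .one .one .r / 2
  | .r, .one, .one => tightExcess .one .one .r / 2
  | .one, .one, .s => tightExcess .one .one .s / 2
  | .s, .one, .one => tightExcess .one .one .s / 2
  | .r, .r, .one => tightExcess .r .r .one / 2
  | .one, .r, .r => tightExcess .r .r .one / 2
  | .r, .r, .s => tightExcess .r .r .s / 2
  | .s, .r, .r => tightExcess .r .r .s / 2
  | .s, .s, .one => tightExcess .s .s .one / 2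
  | .one, .s, .s => tightExcess .s .s .one / 2
  | .s, .s, .r => tightExcess .s .s .r / 2
  | .r, .s, .s => tightExcess .s .s .r / 2
  | .one, .s, .r => 0
  | .r, .s, .one => 0
  | .one, .r, .s => -tightExcess .r .r .one / 4
  | .s, .r, .one => -tightExcess .r .r .one / 4
  | .r, .one, .s => -tightExcess .one .one .s / 4
  | .s, .one, .r => -tightExcess .one .one .s / 4

theorem tightAngle_comm (x q y : Size) : tightAngle x q y = tightAngle y q x := by
  unfold tightAngle
  congr 1
  ring

theorem tightExcess_swap (x y z : Size) : tightExcess x y z = tightExcess y x z := by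
  have h : tightArea x y z = tightArea y x z := by
    unfold tightArea
    congr 1
    ring
  unfold tightExcess tightCov
  rw [h, tightAngle_comm x z y]
  ring

theorem tightExcess_rotate (x y z : Size) : tightExcess x y z = tightExcess y z x := by
  have h : tightArea x y z = tightArea y z x := by
    unfold tightArea
    congr 1
    ring
  unfold tightExcess tightCov
  rw [h, tightAngle_comm y x z, tightAngle_comm x y z, tightAngle_comm x z y]
  ring

theorem tightArea_pos (x y z : Size) : 0 < tightArea x y z := by
  have := x.radius_pos
  have := y.radius_pos
  have := z.radius_pos
  unfold tightArea
  positivity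

theorem tightExcess_cell :
    4 * tightExcess .one .r .s + tightExcess .one .one .s + tightExcess .r .r .one = 0 := by
  have h1 := tightArea_pos .one .r .s
  have h2 := tightArea_pos .one .one .s
  have h3 := tightArea_pos .one .r .r
  rw [← tightExcess_rotate .one .r .r]
  unfold tightExcess targetDensity
  field_simp
  ring

theorem isTightPotential_iff (V : Size → Size → Size → ℝ) :
    IsTightPotential V ↔ V = tightPotential := by
  have hcell := tightExcess_cell
  constructor
  · intro h
    funext x q y
    have hs := h.symm
    have he := h.sum_eq_excess
    have h1 := h.corona_s
    have h2 := h.corona_r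
    have h3 := h.corona_one
    have a1 := h.apex .one .r (by simp)
    have a2 := h.apex .one .s (by simp)
    have a3 := h.apex .r .one (by simp)
    have a4 := h.apex .r .s (by simp)
    have a5 := h.apex .s .one (by simp)
    have a6 := h.apex .s .r (by simp)
    cases x <;> cases q <;> cases y <;> simp only [tightPotential] <;>
      linarith [he .one .one .one, he .r .r .r, he .s .s .s, he .one .one .r, he .one .one .s,
        he .r .r .one, he .r .r .s, he .s .s .one, he .s .s .r, hs .one .one .r, hs .one .one .s,
        hs .r .r .one, hs .r .r .s, hs .s .s .one, hs .s .s .r, hs .one .r .s, hs .one .s .r,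
        hs .r .one .s]
  · rintro rfl
    have e1 := tightExcess_swap
    have e2 := tightExcess_rotate
    refine ⟨?_, ?_, ?_, ?_, ?_, ?_⟩
    · intro x q y
      cases x <;> cases q <;> cases y <;> rfl
    · intro x y z
      cases x <;> cases y <;> cases z <;> simp only [tightPotential] <;>
        linarith [e2 .one .one .r, e2 .one .r .one, e2 .one .one .s, e2 .one .s .one,
          e2 .r .r .one, e2 .r .one .r, e2 .r .r .s, e2 .r .s .r,
          e2 .s .s .one, e2 .s .one .s, e2 .s .s .r, e2 .s .r .s,
          e2 .one .r .s, e2 .r .s .one, e2 .s .one .r, e1 .one .r .s, e1 .r .s .one,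
          e1 .s .one .r]
    · intro x q hxq
      cases x <;> cases q <;> first | rfl | exact absurd rfl hxq
    · simp only [tightPotential]; ring
    · simp only [tightPotential]; ring
    · simp only [tightPotential]; ring

/-! ### Packings and their FM-triangulations -/

/-- The Euclidean plane. -/
abbrev Plane : Type := EuclideanSpace ℝ (Fin 2)

/-- A packing of the plane by interior-disjoint circles of sizes `1`, `r` and `s`. Only the sizes
attached to the points of `centers` matter. -/
structure Packing where
  /-- The centers of the circles. -/
  centers : Set Plane
  /-- The size of the circle with a given center. -/
  size : Plane → Size
  interior_disjoint : centers.Pairwise fun c d => (size c).radius + (size d).radius ≤ dist c d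

namespace Packing

/-- A packing is saturated if no further circle of size `s` can be added. -/
def IsSaturated (P : Packing) : Prop :=
  ¬ ∃ p : Plane, ∀ c ∈ P.centers, Size.s.radius + (P.size c).radius ≤ dist p c

/-- The (closed) cell of the circle with center `c`: the points of the plane that are at least as
close to this circle as to any other. The distance to a circle with center `c` and radius `ρ` is the
signed one, `dist p c - ρ`. -/
def cell (P : Packing) (c : Plane) : Set Plane :=
  {p | ∀ d ∈ P.centers, dist p c - (P.size c).radius ≤ dist p d - (P.size d).radius}

/-- `K` is an FM-triangulation of the packing `P`: a triangulation of the whole plane, with the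
centers of the circles as vertices, which is dual to the cells, i.e., the cells of the three
vertices of each triangle have a point in common (the center of a support circle of the triangle).
If more than three cells meet in a point, any choice of the triangles is allowed. -/
structure IsFMTriangulation (P : Packing) (K : Geometry.SimplicialComplex ℝ Plane) : Prop where
  vertices_eq : K.vertices = P.centers
  covers : ∀ p : Plane, ∃ T ∈ K.faces, T.card = 3 ∧ p ∈ convexHull ℝ (T : Set Plane)
  dual : ∀ T ∈ K.faces, T.card = 3 → ∃ p : Plane, ∀ c ∈ T, p ∈ P.cell c

/-- The potential in `v` of the triangle with vertices `x`, `v`, `y`. -/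
def cornerPotential (P : Packing) (m : Size → ℝ) (x v y : Plane) : ℝ :=
  tightPotential (P.size x) (P.size v) (P.size y) +
    m (P.size v) * |EuclideanGeometry.angle x v y - tightAngle (P.size x) (P.size v) (P.size y)|

open Classical in
/-- The vertex potential `U_v(T)` of the vertex `v` of the triangle `T`. It is symmetric in the two
other vertices of `T`: the sum below consists of the two equal terms that correspond to the two
orderings of these vertices (see `vertexPotential_eq`). -/
def vertexPotential (P : Packing) (m : Size → ℝ) (v : Plane) (T : Finset Plane) : ℝ :=
  (∑ e ∈ (T.erase v).offDiag, P.cornerPotential m e.1 v e.2) / 2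

theorem cornerPotential_comm (P : Packing) (m : Size → ℝ) (x v y : Plane) :
    P.cornerPotential m x v y = P.cornerPotential m y v x := by
  unfold cornerPotential
  rw [((isTightPotential_iff _).2 rfl).symm, EuclideanGeometry.angle_comm, tightAngle_comm]

open Classical in
theorem vertexPotential_eq (P : Packing) (m : Size → ℝ) {v x y : Plane} (hx : x ≠ v) (hy : y ≠ v)
    (hxy : x ≠ y) : P.vertexPotential m v {v, x, y} = P.cornerPotential m x v y := by
  have h1 : (({v, x, y} : Finset Plane).erase v).offDiag = {(x, y), (y, x)} := by
    ext ⟨a, b⟩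
    simp only [Finset.mem_offDiag, Finset.mem_erase, Finset.mem_insert, Finset.mem_singleton,
      Prod.mk.injEq]
    grind
  unfold vertexPotential
  rw [h1, Finset.sum_pair (by simp [hxy]), cornerPotential_comm P m y v x]
  ring

end Packing

end

end TernaryPacking

/-! Let `v` carry a circle of size `q`, and put `μ = minSlope q`. The triangles at `v` close up
around it, so their angles at `v` sum to `2π`. By the triangle inequality the deviations `|angle -
tight angle|` sum to at least `|2π - Σ α|`, where `α` runs over the tight angles. It is therefore
enough that `Σ V + μ |2π - Σ α| ≥ 0` (`corona_nonneg`), which involves only the sizes of consecutive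
neighbors of `v`.

Since `|t| ≥ ±t`, this holds as soon as `Σ V ≥ 0`, or `Σ (V + μ α) ≥ 2πμ`, or `Σ (μ α - V) ≤ 2πμ`
(`corona_trichotomy`). All the numbers `V + μ α` are positive and bounded below, so the second
alternative disposes of every corona with many circles. The others are finitely many, up to the
counts of consecutive pairs, and are checked in integer arithmetic. The integers come from certified
enclosures of the radii, angles, areas and excesses. The three slopes exceed by less than `2 *
10⁻¹²` the values that make `Σ V + μ |2π - Σ α|` vanish for the coronas `1srrrss` around `1`,
`1s1s1s` around `r` and `1111s` around `s`.

The geometric input is the angle sum `2π` (`exists_corona`). Saturation and duality with the cells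
bound the diameters of the triangles, hence only finitely many lie near `v`, and those containing
`v` cover a neighborhood of it. Each angle is a difference of arguments, plus `2π` for the unique
triangle that crosses the branch cut, so the sum telescopes. -/

namespace TernaryPacking

noncomputable section

open Finset Filter Topology

/-! ### Taylor polynomials of the cosine -/

/-- The Taylor polynomial of the cosine with `n` terms. -/
def cosTaylor (n : ℕ) (x : ℝ) : ℝ :=
  ∑ k ∈ range n, (-1) ^ k * x ^ (2 * k) / (2 * k).factorial

/-- The Taylor polynomial of the sine with `n` terms. -/
def sinTaylor (n : ℕ) (x : ℝ) : ℝ :=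
  ∑ k ∈ range n, (-1) ^ k * x ^ (2 * k + 1) / (2 * k + 1).factorial

theorem hasDerivAt_sinTaylor (n : ℕ) (x : ℝ) : HasDerivAt (sinTaylor n) (cosTaylor n x) x := by
  unfold sinTaylor cosTaylor
  refine HasDerivAt.fun_sum fun k _ => ?_
  refine (((hasDerivAt_pow (2 * k + 1) x).const_mul ((-1) ^ k)).div_const _).congr_deriv ?_
  rw [Nat.factorial_succ]
  push_cast
  have : ((2 * k).factorial : ℝ) ≠ 0 := by positivity
  field_simp

theorem hasDerivAt_cosTaylor (n : ℕ) (x : ℝ) :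
    HasDerivAt (cosTaylor (n + 1)) (-sinTaylor n x) x := by
  have h : cosTaylor (n + 1) = fun x => (∑ k ∈ range n,
      (-1) ^ (k + 1) * x ^ (2 * (k + 1)) / ((2 * (k + 1)).factorial : ℝ)) + 1 := by
    funext x
    unfold cosTaylor
    rw [sum_range_succ']
    simp
  rw [h]
  unfold sinTaylor
  rw [← sum_neg_distrib]
  refine (HasDerivAt.fun_sum fun k _ => ?_).add_const 1
  refine (((hasDerivAt_pow (2 * (k + 1)) x).const_mul ((-1) ^ (k + 1))).div_const _).congr_deriv ?_
  rw [show 2 * (k + 1) = 2 * k + 1 + 1 by ring, Nat.factorial_succ (2 * k + 1)]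
  push_cast
  have : ((2 * k + 1).factorial : ℝ) ≠ 0 := by positivity
  field_simp
  ring

theorem nonneg_of_hasDerivAt_nonneg {f f' : ℝ → ℝ} (h : ∀ x, HasDerivAt f (f' x) x) (h0 : f 0 = 0)
    (h' : ∀ x, 0 ≤ x → 0 ≤ f' x) {x : ℝ} (hx : 0 ≤ x) : 0 ≤ f x := by
  have hm : MonotoneOn f (Set.Ici 0) := by
    refine monotoneOn_of_deriv_nonneg (convex_Ici 0)
      (fun y _ => (h y).continuousAt.continuousWithinAt)
      (fun y _ => (h y).differentiableAt.differentiableWithinAt) fun y hy => ?_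
    rw [interior_Ici] at hy
    rw [(h y).deriv]
    exact h' y (le_of_lt hy)
  rw [← h0]
  exact hm Set.self_mem_Ici hx hx

/-- Each remainder vanishes at `0` and its derivative is, up to sign, the preceding remainder.
Integrating alternately from cosine to sine and back propagates the sign from `cos x ≤ 1`. -/
theorem neg_one_pow_mul_cos_sub_taylor_nonneg (n : ℕ) :
    (∀ x : ℝ, 0 ≤ x → 0 ≤ (-1) ^ (n + 1) * (Real.cos x - cosTaylor (n + 1) x)) ∧
      ∀ x : ℝ, 0 ≤ x → 0 ≤ (-1) ^ (n + 1) * (Real.sin x - sinTaylor (n + 1) x) := by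
  have key : ∀ n : ℕ, (∀ x : ℝ, 0 ≤ x → 0 ≤ (-1) ^ (n + 1) * (Real.cos x - cosTaylor (n + 1) x)) →
      ∀ x : ℝ, 0 ≤ x → 0 ≤ (-1) ^ (n + 1) * (Real.sin x - sinTaylor (n + 1) x) := fun n hn x hx =>
    nonneg_of_hasDerivAt_nonneg
      (fun y => ((Real.hasDerivAt_sin y).sub (hasDerivAt_sinTaylor (n + 1) y)).const_mul _)
      (by simp [sinTaylor]) hn hx
  induction n with
  | zero =>
    have h1 : ∀ x : ℝ, 0 ≤ x → 0 ≤ (-1) ^ (0 + 1) * (Real.cos x - cosTaylor (0 + 1) x) :=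
      fun x _ => by simpa [cosTaylor] using Real.cos_le_one x
    exact ⟨h1, key 0 h1⟩
  | succ n ih =>
    have h1 : ∀ x : ℝ, 0 ≤ x →
        0 ≤ (-1) ^ (n + 1 + 1) * (Real.cos x - cosTaylor (n + 1 + 1) x) := fun x hx =>
      nonneg_of_hasDerivAt_nonneg (fun y =>
        ((Real.hasDerivAt_cos y).sub (hasDerivAt_cosTaylor (n + 1) y)).const_mul _)
        (by simp [cosTaylor, sum_range_succ']) (fun y hy => by
          have := ih.2 y hy
          rw [pow_succ]
          linarith) hx
    exact ⟨h1, key _ h1⟩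

/-- This bound and the next differ by `x ^ 24 / 24!`, which is below `10⁻²¹` for the tight angles
and so negligible against the width `3 * 10⁻²⁰` of their enclosures. -/
theorem cosTaylor_twelve_le {x : ℝ} (hx : 0 ≤ x) : cosTaylor 12 x ≤ Real.cos x := by
  have := (neg_one_pow_mul_cos_sub_taylor_nonneg 11).1 x hx
  norm_num at this
  exact this

theorem cos_le_cosTaylor_thirteen {x : ℝ} (hx : 0 ≤ x) : Real.cos x ≤ cosTaylor 13 x := by
  have := (neg_one_pow_mul_cos_sub_taylor_nonneg 12).1 x hx
  norm_num at this
  exact this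

/-! ### Bounds for the radii -/

/-- Lower bounds for the radii. -/
def radiusLo : Size → ℝ
  | .one => 1
  | .r => 0.834306042853017439677530
  | .s => 0.651050185882609199532699

/-- Upper bounds for the radii. -/
def radiusHi : Size → ℝ
  | .one => 1
  | .r => 0.834306042853017439677531
  | .s => 0.651050185882609199532700

/-- The polynomial already changes sign on this tiny interval, and uniqueness on the large one
identifies the root found there. -/
theorem midRadius_mem :
    midRadius ∈ Set.Icc (0.834306042853017439677530 : ℝ) 0.834306042853017439677531 := by
  obtain ⟨x, hx, h0⟩ : (0 : ℝ) ∈ (fun x : ℝ => 4 * x ^ 8 - 36 * x ^ 7 - 27 * x ^ 6 + 162 * x ^ 5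
      + 135 * x ^ 4 - 88 * x ^ 3 - 73 * x ^ 2 - 14 * x + 1) ''
      Set.Icc (0.834306042853017439677530 : ℝ) 0.834306042853017439677531 := by
    apply intermediate_value_Icc (by norm_num)
    · fun_prop
    · constructor <;> norm_num
  have : x = midRadius := existsUnique_midRadius.choose_spec.2 x
    ⟨⟨le_trans (by norm_num) hx.1, hx.2.trans (by norm_num)⟩, h0⟩
  rwa [this] at hx

theorem smallRadius_mem :
    smallRadius ∈ Set.Icc (0.651050185882609199532699 : ℝ) 0.651050185882609199532700 := by
  obtain ⟨x, hx, h0⟩ : (0 : ℝ) ∈ (fun x : ℝ => 89 * x ^ 8 + 1344 * x ^ 7 + 4008 * x ^ 6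
      - 464 * x ^ 5 - 2410 * x ^ 4 + 176 * x ^ 3 + 296 * x ^ 2 - 96 * x + 1) ''
      Set.Icc (0.651050185882609199532699 : ℝ) 0.651050185882609199532700 := by
    apply intermediate_value_Icc (by norm_num)
    · fun_prop
    · constructor <;> norm_num
  have : x = smallRadius := existsUnique_smallRadius.choose_spec.2 x
    ⟨⟨le_trans (by norm_num) hx.1, hx.2.trans (by norm_num)⟩, h0⟩
  rwa [this] at hx

theorem radiusLo_le (x : Size) : radiusLo x ≤ x.radius := by
  cases x
  · exact le_rfl
  · exact midRadius_mem.1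
  · exact smallRadius_mem.1

theorem le_radiusHi (x : Size) : x.radius ≤ radiusHi x := by
  cases x
  · exact le_rfl
  · exact midRadius_mem.2
  · exact smallRadius_mem.2

theorem radiusLo_pos (x : Size) : 0 < radiusLo x := by
  cases x <;> norm_num [radiusLo]

theorem radiusHi_pos (x : Size) : 0 < radiusHi x := x.radius_pos.trans_le (le_radiusHi x)

/-! ### Bounds for the angles of the tight triangles -/

/-- Lower bounds for the angles of the tight triangles. -/
def angleLo : Size → Size → Size → ℝ
  | .one, .one, .one => 1.04719755119659774614
  | .one, .one, .r | .r, .one, .one => 0.99421004933397372393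
  | .one, .one, .s | .s, .one, .one => 0.92018230023747079768
  | .r, .one, .r => 0.94437319525803375157
  | .r, .one, .s | .s, .one, .r => 0.87461187786165278247
  | .s, .one, .s => 0.81066620059284612965
  | .one, .r, .one => 1.15317255492184579056
  | .one, .r, .r | .r, .r, .one => 1.09860972916587974342
  | .one, .r, .s | .s, .r, .one => 1.02149146221195674750
  | .r, .r, .r => 1.04719755119659774614
  | .r, .r, .s | .s, .r, .r => 0.97437227653016663760
  | .s, .r, .s => 0.90744068789470178057
  | .one, .s, .one => 1.30122805311485164306
  | .one, .s, .r | .r, .s, .one => 1.24548931351618370845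
  | .one, .s, .s | .s, .s, .one => 1.16546322649847355439
  | .r, .s, .r => 1.19284810052945996322
  | .r, .s, .s | .s, .s, .r => 1.11707598284754572892
  | .s, .s, .s => 1.04719755119659774614

/-- Upper bounds for the angles of the tight triangles. -/
def angleHi : Size → Size → Size → ℝ
  | .one, .one, .one => 1.04719755119659774617
  | .one, .one, .r | .r, .one, .one => 0.99421004933397372396
  | .one, .one, .s | .s, .one, .one => 0.92018230023747079771
  | .r, .one, .r => 0.94437319525803375160
  | .r, .one, .s | .s, .one, .r => 0.87461187786165278250
  | .s, .one, .s => 0.81066620059284612968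
  | .one, .r, .one => 1.15317255492184579059
  | .one, .r, .r | .r, .r, .one => 1.09860972916587974345
  | .one, .r, .s | .s, .r, .one => 1.02149146221195674753
  | .r, .r, .r => 1.04719755119659774617
  | .r, .r, .s | .s, .r, .r => 0.97437227653016663763
  | .s, .r, .s => 0.90744068789470178060
  | .one, .s, .one => 1.30122805311485164309
  | .one, .s, .r | .r, .s, .one => 1.24548931351618370848
  | .one, .s, .s | .s, .s, .one => 1.16546322649847355442
  | .r, .s, .r => 1.19284810052945996325
  | .r, .s, .s | .s, .s, .r => 1.11707598284754572895
  | .s, .s, .s => 1.04719755119659774617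

/-- In this form numerator and denominator are increasing in the radii, so that bounds for the radii
can be substituted separately in each. -/
theorem tightAngle_eq (x q y : Size) : tightAngle x q y =
    Real.arccos
      (1 - 2 * x.radius * y.radius / ((q.radius + x.radius) * (q.radius + y.radius))) := by
  have := x.radius_pos
  have := q.radius_pos
  have := y.radius_pos
  unfold tightAngle
  congr 1
  field_simp
  ring

theorem tightAngle_le_of_cosTaylor_le {x q y : Size} {t : ℝ} (ht : 0 ≤ t)
    (h : cosTaylor 13 t ≤
      1 - 2 * radiusHi x * radiusHi y / ((radiusLo q + radiusLo x) * (radiusLo q + radiusLo y))) :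
    tightAngle x q y ≤ t := by
  have := x.radius_pos
  have := q.radius_pos
  have := y.radius_pos
  have := radiusLo_pos x
  have := radiusLo_pos q
  have := radiusLo_pos y
  have := radiusHi_pos x
  have := radiusHi_pos y
  rw [tightAngle_eq]
  rcases le_total t Real.pi with htp | htp
  · rw [← Real.arccos_cos ht htp]
    apply Real.arccos_le_arccos
    refine (cos_le_cosTaylor_thirteen ht).trans (h.trans ?_)
    gcongr <;> first | apply radiusLo_le | apply le_radiusHi
  · exact (Real.arccos_le_pi _).trans htp

theorem le_tightAngle_of_le_cosTaylor {x q y : Size} {t : ℝ} (ht : 0 ≤ t) (ht3 : t ≤ 3)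
    (h : 1 - 2 * radiusLo x * radiusLo y / ((radiusHi q + radiusHi x) * (radiusHi q + radiusHi y))
      ≤ cosTaylor 12 t) :
    t ≤ tightAngle x q y := by
  have := x.radius_pos
  have := q.radius_pos
  have := y.radius_pos
  have := radiusLo_pos x
  have := radiusLo_pos q
  have := radiusLo_pos y
  have := radiusHi_pos x
  have := radiusHi_pos q
  have := radiusHi_pos y
  have htp : t ≤ Real.pi := ht3.trans Real.pi_gt_three.le
  rw [tightAngle_eq]
  conv_lhs => rw [← Real.arccos_cos ht htp]
  apply Real.arccos_le_arccos
  refine le_trans (le_trans ?_ h) (cosTaylor_twelve_le ht)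
  gcongr <;> first | apply radiusLo_le | apply le_radiusHi

theorem tightAngle_le_angleHi (x q y : Size) : tightAngle x q y ≤ angleHi x q y := by
  cases x <;> cases q <;> cases y <;> apply tightAngle_le_of_cosTaylor_le <;>
    norm_num [angleHi, cosTaylor, sum_range_succ, Nat.factorial, radiusHi, radiusLo]

theorem angleLo_le_tightAngle (x q y : Size) : angleLo x q y ≤ tightAngle x q y := by
  cases x <;> cases q <;> cases y <;> apply le_tightAngle_of_le_cosTaylor <;>
    norm_num [angleLo, cosTaylor, sum_range_succ, Nat.factorial, radiusHi, radiusLo]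

theorem angleLo_nonneg (x q y : Size) : 0 ≤ angleLo x q y := by
  cases x <;> cases q <;> cases y <;> norm_num [angleLo]

/-! ### Bounds for the areas, the density and the excesses -/

theorem le_tightArea {x y z : Size} {a : ℝ}
    (h : a ^ 2 ≤ (radiusLo x + radiusLo y + radiusLo z) * radiusLo x * radiusLo y * radiusLo z) :
    a ≤ tightArea x y z := by
  have := radiusLo_pos x
  have := radiusLo_pos y
  have := radiusLo_pos z
  have := x.radius_pos
  have := y.radius_pos
  have := z.radius_pos
  refine Real.le_sqrt_of_sq_le (h.trans ?_)
  gcongr <;> apply radiusLo_le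

theorem tightArea_le {x y z : Size} {a : ℝ} (ha : 0 ≤ a)
    (h : (radiusHi x + radiusHi y + radiusHi z) * radiusHi x * radiusHi y * radiusHi z ≤ a ^ 2) :
    tightArea x y z ≤ a := by
  have := x.radius_pos
  have := y.radius_pos
  have := z.radius_pos
  refine Real.sqrt_le_iff.2 ⟨ha, le_trans ?_ h⟩
  have := radiusHi_pos x
  have := radiusHi_pos y
  have := radiusHi_pos z
  gcongr <;> apply le_radiusHi

/-- Lower bounds for the covered areas of the tight triangles. -/
def covLo (x y z : Size) : ℝ :=
  angleLo y x z / 2 * radiusLo x ^ 2 + angleLo x y z / 2 * radiusLo y ^ 2 +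
    angleLo x z y / 2 * radiusLo z ^ 2

/-- Upper bounds for the covered areas of the tight triangles. -/
def covHi (x y z : Size) : ℝ :=
  angleHi y x z / 2 * radiusHi x ^ 2 + angleHi x y z / 2 * radiusHi y ^ 2 +
    angleHi x z y / 2 * radiusHi z ^ 2

theorem covLo_le_tightCov (x y z : Size) : covLo x y z ≤ tightCov x y z := by
  have h (x y z : Size) :
      angleLo y x z / 2 * radiusLo x ^ 2 ≤ tightAngle y x z / 2 * x.radius ^ 2 := by
    have := radiusLo_pos x
    have h0 := angleLo_nonneg y x z
    have h1 := angleLo_le_tightAngle y x z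
    have h2 := h0.trans h1
    gcongr
    exact radiusLo_le x
  exact add_le_add (add_le_add (h _ _ _) (h _ _ _)) (h _ _ _)

theorem tightCov_le_covHi (x y z : Size) : tightCov x y z ≤ covHi x y z := by
  have h (x y z : Size) :
      tightAngle y x z / 2 * x.radius ^ 2 ≤ angleHi y x z / 2 * radiusHi x ^ 2 := by
    have := x.radius_pos
    have h0 := (angleLo_nonneg y x z).trans (angleLo_le_tightAngle y x z)
    have h1 := tightAngle_le_angleHi y x z
    have h2 := h0.trans h1
    gcongr
    exact le_radiusHi x
  exact add_le_add (add_le_add (h _ _ _) (h _ _ _)) (h _ _ _)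

theorem targetDensity_mem :
    targetDensity ∈ Set.Icc (0.90930650162417496680 : ℝ) 0.90930650162417496690 := by
  -- Decimal enclosures of the three square roots, verified by squaring.
  have a1 : (1.16188795876473760212 : ℝ) ≤ tightArea .one .r .s :=
    le_tightArea (by norm_num [radiusLo])
  have a2 : tightArea .one .r .s ≤ (1.16188795876473760215 : ℝ) :=
    tightArea_le (by norm_num) (by norm_num [radiusHi])
  have b1 : (1.31376052471635727333 : ℝ) ≤ tightArea .one .one .s :=
    le_tightArea (by norm_num [radiusLo])
  have b2 : tightArea .one .one .s ≤ (1.31376052471635727336 : ℝ) :=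
    tightArea_le (by norm_num) (by norm_num [radiusHi])
  have c1 : (1.36291293542185555108 : ℝ) ≤ tightArea .one .r .r :=
    le_tightArea (by norm_num [radiusLo])
  have c2 : tightArea .one .r .r ≤ (1.36291293542185555111 : ℝ) :=
    tightArea_le (by norm_num) (by norm_num [radiusHi])
  have d1 := covLo_le_tightCov .one .r .s
  have d2 := tightCov_le_covHi .one .r .s
  have e1 := covLo_le_tightCov .one .one .s
  have e2 := tightCov_le_covHi .one .one .s
  have f1 := covLo_le_tightCov .one .r .r
  have f2 := tightCov_le_covHi .one .r .r
  norm_num [covLo, angleLo, radiusLo] at d1 e1 f1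
  norm_num [covHi, angleHi, radiusHi] at d2 e2 f2
  have hpos : 0 < 4 * tightArea .one .r .s + tightArea .one .one .s + tightArea .one .r .r := by
    linarith
  unfold targetDensity
  constructor
  · rw [le_div_iff₀ hpos]
    linarith
  · rw [div_le_iff₀ hpos]
    linarith

/-- Interval arithmetic for `δ area - cov`: `a₀` and `a₁` enclose the area, and every hypothesis is
a comparison of explicit rationals. -/
theorem tightExcess_mem {x y z : Size} {a₀ a₁ e₀ e₁ : ℝ}
    (h₀ : a₀ ^ 2 ≤ (radiusLo x + radiusLo y + radiusLo z) * radiusLo x * radiusLo y * radiusLo z)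
    (h₁ : (radiusHi x + radiusHi y + radiusHi z) * radiusHi x * radiusHi y * radiusHi z ≤ a₁ ^ 2)
    (ha₀ : 0 ≤ a₀) (ha₁ : 0 ≤ a₁)
    (he₀ : e₀ ≤ 0.90930650162417496680 * a₀ - covHi x y z)
    (he₁ : 0.90930650162417496690 * a₁ - covLo x y z ≤ e₁) :
    tightExcess x y z ∈ Set.Icc e₀ e₁ := by
  obtain ⟨d0, d1⟩ := targetDensity_mem
  have hd : 0 ≤ targetDensity := le_trans (by norm_num) d0
  have := mul_le_mul d0 (le_tightArea h₀) ha₀ hd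
  have := mul_le_mul d1 (tightArea_le ha₁ h₁) (tightArea_pos x y z).le (hd.trans d1)
  have := covLo_le_tightCov x y z
  have := tightCov_le_covHi x y z
  unfold tightExcess
  constructor <;> linarith

theorem tightExcess_one_one_one_mem :
    tightExcess .one .one .one ∈ Set.Icc (0.004168733670886263 : ℝ) 0.004168733670886266 :=
  tightExcess_mem (a₀ := 1.73205080756887729351) (a₁ := 1.73205080756887729354)
    (by norm_num [radiusLo]) (by norm_num [radiusHi]) (by norm_num) (by norm_num)
    (by norm_num [covHi, angleHi, radiusHi]) (by norm_num [covLo, angleLo, radiusLo])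

theorem tightExcess_one_one_r_mem :
    tightExcess .one .one .r ∈ Set.Icc (0.002734652566671948 : ℝ) 0.002734652566671951 :=
  tightExcess_mem (a₀ := 1.53775116935318760035) (a₁ := 1.53775116935318760038)
    (by norm_num [radiusLo]) (by norm_num [radiusHi]) (by norm_num) (by norm_num)
    (by norm_num [covHi, angleHi, radiusHi]) (by norm_num [covLo, angleLo, radiusLo])

theorem tightExcess_one_one_s_mem :
    tightExcess .one .one .s ∈ Set.Icc ((-0.001344702677601712) : ℝ) (-0.001344702677601709) :=
  tightExcess_mem (a₀ := 1.31376052471635727333) (a₁ := 1.31376052471635727336)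
    (by norm_num [radiusLo]) (by norm_num [radiusHi]) (by norm_num) (by norm_num)
    (by norm_num [covHi, angleHi, radiusHi]) (by norm_num [covLo, angleLo, radiusLo])

theorem tightExcess_r_r_one_mem :
    tightExcess .r .r .one ∈ Set.Icc (0.002413486297842671 : ℝ) 0.002413486297842674 :=
  tightExcess_mem (a₀ := 1.36291293542185555108) (a₁ := 1.36291293542185555111)
    (by norm_num [radiusLo]) (by norm_num [radiusHi]) (by norm_num) (by norm_num)
    (by norm_num [covHi, angleHi, radiusHi]) (by norm_num [covLo, angleLo, radiusLo])

theorem tightExcess_r_r_r_mem :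
    tightExcess .r .r .r ∈ Set.Icc (0.002901716160631556 : ℝ) 0.002901716160631559 :=
  tightExcess_mem (a₀ := 1.20562267013067565037) (a₁ := 1.20562267013067565040)
    (by norm_num [radiusLo]) (by norm_num [radiusHi]) (by norm_num) (by norm_num)
    (by norm_num [covHi, angleHi, radiusHi]) (by norm_num [covLo, angleLo, radiusLo])

theorem tightExcess_r_r_s_mem :
    tightExcess .r .r .s ∈ Set.Icc (0.001267118710048838 : ℝ) 0.001267118710048841 :=
  tightExcess_mem (a₀ := 1.02528594100332578035) (a₁ := 1.02528594100332578038)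
    (by norm_num [radiusLo]) (by norm_num [radiusHi]) (by norm_num) (by norm_num)
    (by norm_num [covHi, angleHi, radiusHi]) (by norm_num [covLo, angleLo, radiusLo])

theorem tightExcess_s_s_one_mem :
    tightExcess .s .s .one ∈ Set.Icc ((-0.001105113003917209) : ℝ) (-0.001105113003917206) :=
  tightExcess_mem (a₀ := 0.98781722466212719229) (a₁ := 0.98781722466212719232)
    (by norm_num [radiusLo]) (by norm_num [radiusHi]) (by norm_num) (by norm_num)
    (by norm_num [covHi, angleHi, radiusHi]) (by norm_num [covLo, angleLo, radiusLo])

theorem tightExcess_s_s_r_mem :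
    tightExcess .s .s .r ∈ Set.Icc (0.001057605965225627 : ℝ) 0.001057605965225630 :=
  tightExcess_mem (a₀ := 0.86919876075871870395) (a₁ := 0.86919876075871870398)
    (by norm_num [radiusLo]) (by norm_num [radiusHi]) (by norm_num) (by norm_num)
    (by norm_num [covHi, angleHi, radiusHi]) (by norm_num [covLo, angleLo, radiusLo])

theorem tightExcess_s_s_s_mem :
    tightExcess .s .s .s ∈ Set.Icc (0.001766985902430120 : ℝ) 0.001766985902430123 :=
  tightExcess_mem (a₀ := 0.73415804435792981438) (a₁ := 0.73415804435792981441)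
    (by norm_num [radiusLo]) (by norm_num [radiusHi]) (by norm_num) (by norm_num)
    (by norm_num [covHi, angleHi, radiusHi]) (by norm_num [covLo, angleLo, radiusLo])

/-! ### Certified weights of the corners of the tight triangles -/

/-- The least admissible slopes of the vertex potentials. -/
def minSlope : Size → ℝ
  | .one => 0.115610891330759
  | .r => 0.023471932071104
  | .s => 0.022750796636041

/-- Lower bounds for `10 ^ 18 * (V x q y + μ q * α x q y)`. -/
def outerWeight : Size → Size → Size → ℕ
  | .one, .one, .one => 122457020183522214
  | .one, .one, .r | .r, .one, .one => 116308836256834552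
  | .one, .one, .s | .s, .one, .one => 105710744578441229
  | .r, .one, .r => 109179826852658187
  | .r, .one, .s | .s, .one, .r => 101450834437455027
  | .s, .one, .s => 93721842022258808
  | .one, .r, .one => 27067187875387008
  | .one, .r, .r | .r, .r, .one => 26993236084556825
  | .one, .r, .s | .s, .r, .one => 23373006637791076
  | .r, .r, .r => 25546988506923511
  | .r, .r, .s | .s, .r, .r => 23503959241707450
  | .s, .r, .s => 21299386184820323
  | .one, .s, .one => 29603974813527543
  | .one, .s, .r | .r, .s, .one => 28335874084169003
  | .one, .s, .s | .s, .s, .one => 25962660350892355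
  | .r, .s, .r => 27138244552833531
  | .r, .s, .s | .s, .s, .r => 25943171495382948
  | .s, .s, .s => 24413573825843966

/-- Upper bounds for `10 ^ 18 * (μ q * α x q y - V x q y)`. -/
def innerWeight : Size → Size → Size → ℕ
  | .one, .one, .one => 119677864402931378
  | .one, .one, .r | .r, .one, .one => 113574183690162609
  | .one, .one, .s | .s, .one, .one => 107055447256042947
  | .r, .one, .r => 109179826852658194
  | .r, .one, .s | .s, .one, .r => 100778483098654179
  | .s, .one, .s => 93721842022258815
  | .one, .r, .one => 27067187875387015
  | .one, .r, .r | .r, .r, .one => 24579749786714160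
  | .one, .r, .s | .s, .r, .one => 24579749786712419
  | .r, .r, .r => 23612511066502480
  | .r, .r, .s | .s, .r, .r => 22236840531658617
  | .s, .r, .s => 21299386184820330
  | .one, .s, .one => 29603974813527550
  | .one, .s, .r | .r, .s, .one => 28335874084169010
  | .one, .s, .s | .s, .s, .one => 27067773354809569
  | .r, .s, .r => 27138244552833538
  | .r, .s, .s | .s, .s, .r => 24885565530157326
  | .s, .s, .s => 23235583224223892

/-- An upper bound for `10 ^ 18 * (2 * π * μ q)`. -/
def outerTurn : Size → ℕ
  | .one => 726404653759360780
  | .r => 147478498720277975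
  | .s => 142947471150203575

/-- A lower bound for `10 ^ 18 * (2 * π * μ q)`. -/
def innerTurn : Size → ℕ
  | .one => 726404653759360777
  | .r => 147478498720277972
  | .s => 142947471150203572

/-- Weights and turns are rounded in opposite directions, so that a comparison of integers implies
the one between real numbers. -/
theorem outerWeight_le (x q y : Size) : (outerWeight x q y : ℝ) ≤
    10 ^ 18 * (tightPotential x q y + minSlope q * tightAngle x q y) := by
  have h := angleLo_le_tightAngle x q y
  have h111 := tightExcess_one_one_one_mem
  have h11r := tightExcess_one_one_r_mem
  have h11s := tightExcess_one_one_s_mem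
  have hrr1 := tightExcess_r_r_one_mem
  have hrrr := tightExcess_r_r_r_mem
  have hrrs := tightExcess_r_r_s_mem
  have hss1 := tightExcess_s_s_one_mem
  have hssr := tightExcess_s_s_r_mem
  have hsss := tightExcess_s_s_s_mem
  rw [Set.mem_Icc] at *
  cases x <;> cases q <;> cases y <;>
    simp only [outerWeight, minSlope, tightPotential, angleLo] at h ⊢ <;> push_cast <;> linarith

theorem le_innerWeight (x q y : Size) :
    10 ^ 18 * (minSlope q * tightAngle x q y - tightPotential x q y) ≤ innerWeight x q y := by
  have h := tightAngle_le_angleHi x q y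
  have h111 := tightExcess_one_one_one_mem
  have h11r := tightExcess_one_one_r_mem
  have h11s := tightExcess_one_one_s_mem
  have hrr1 := tightExcess_r_r_one_mem
  have hrrr := tightExcess_r_r_r_mem
  have hrrs := tightExcess_r_r_s_mem
  have hss1 := tightExcess_s_s_one_mem
  have hssr := tightExcess_s_s_r_mem
  have hsss := tightExcess_s_s_s_mem
  rw [Set.mem_Icc] at *
  cases x <;> cases q <;> cases y <;>
    simp only [innerWeight, minSlope, tightPotential, angleHi] at h ⊢ <;> push_cast <;> linarith

theorem le_outerTurn (q : Size) : 10 ^ 18 * (2 * Real.pi * minSlope q) ≤ outerTurn q := by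
  have := Real.pi_lt_d20
  cases q <;> simp only [outerTurn, minSlope] <;> push_cast <;> linarith

theorem innerTurn_le (q : Size) : (innerTurn q : ℝ) ≤ 10 ^ 18 * (2 * Real.pi * minSlope q) := by
  have := Real.pi_gt_d20
  cases q <;> simp only [innerTurn, minSlope] <;> push_cast <;> linarith

/-! ### The finitely many coronas

In the next three lemmas, `a`, `b`, `c`, `d`, `e`, `f` count the pairs of consecutive circles of
sizes `11`, `1r`, `1s`, `rr`, `rs`, `ss` around a circle of size `1`, `r` and `s`. -/

-- At most seven pairs are needed, since eight of the least weight (that of `ss`) already exceed the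
-- turn. The parities hold because a cyclic sequence enters a given size as often as it leaves it.
-- The alternative `2 * c ≤ e` is what makes the potentials sum to a nonnegative number. The corona
-- `1srrrss` (`c = e = d = 2`, `f = 1`) passes the second alternative with almost no slack.
set_option synthInstance.maxSize 100000 in
set_option synthInstance.maxHeartbeats 4000000 in
theorem corona_check_one : ∀ a < 8, ∀ b < 8 - a, ∀ c < 8 - a - b, (b + c) % 2 = 0 →
    ∀ d < 8 - a - b - c, ∀ e < 8 - a - b - c - d, (b + e) % 2 = 0 →
    ∀ f < 8 - a - b - c - d - e,
    2 * c ≤ e ∨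
    726404653759360780 ≤ a * 122457020183522214 + b * 116308836256834552 + c * 105710744578441229
      + d * 109179826852658187 + e * 101450834437455027 + f * 93721842022258808 ∨
    a * 119677864402931378 + b * 113574183690162609 + c * 107055447256042947
      + d * 109179826852658194 + e * 100778483098654179 + f * 93721842022258815
      ≤ 726404653759360777 := by
  decide +kernel

-- At most six pairs are needed, and `c ≤ 2 * b` gives nonnegative potentials. Parity alone lets
-- through counts with an `rr` pair cut off from all other circles, such as `a = d = 1`, `c = 4`,
-- which satisfy none of the other alternatives; hence the exceptional one. The almost sharp case is
-- `c = 6`, by the last alternative.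
set_option synthInstance.maxSize 100000 in
set_option synthInstance.maxHeartbeats 4000000 in
theorem corona_check_r : ∀ a < 7, ∀ b < 7 - a, ∀ c < 7 - a - b, (b + c) % 2 = 0 →
    ∀ d < 7 - a - b - c, ∀ e < 7 - a - b - c - d, (b + e) % 2 = 0 →
    ∀ f < 7 - a - b - c - d - e,
    c ≤ 2 * b ∨ d = 1 ∧ b = 0 ∧ e = 0 ∨
    147478498720277975 ≤ a * 27067187875387008 + b * 26993236084556825 + c * 23373006637791076
      + d * 25546988506923511 + e * 23503959241707450 + f * 21299386184820323 ∨
    a * 27067187875387015 + b * 24579749786714160 + c * 24579749786712419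
      + d * 23612511066502480 + e * 22236840531658617 + f * 21299386184820330
      ≤ 147478498720277972 := by
  decide +kernel

-- At most five pairs are needed; only `1s` pairs have a negative potential. The almost sharp case
-- is `a = 3`, `c = 2`, by the last alternative.
set_option synthInstance.maxSize 100000 in
set_option synthInstance.maxHeartbeats 4000000 in
theorem corona_check_s : ∀ a < 6, ∀ b < 6 - a, ∀ c < 6 - a - b, (b + c) % 2 = 0 →
    ∀ d < 6 - a - b - c, ∀ e < 6 - a - b - c - d, (b + e) % 2 = 0 →
    ∀ f < 6 - a - b - c - d - e,
    c = 0 ∨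
    142947471150203575 ≤ a * 29603974813527543 + b * 28335874084169003 + c * 25962660350892355
      + d * 27138244552833531 + e * 25943171495382948 + f * 24413573825843966 ∨
    a * 29603974813527550 + b * 28335874084169010 + c * 27067773354809569
      + d * 27138244552833538 + e * 24885565530157326 + f * 23235583224223892
      ≤ 142947471150203572 := by
  decide +kernel

open Classical in
/-- The number of elements `x` of `N` of size `a` whose successor has size `b`. -/
def pairCount {ι : Type*} (N : Finset ι) (size : ι → Size) (next : ι → ι) (a b : Size) : ℕ :=
  #{x ∈ N | size x = a ∧ size (next x) = b}

/-! ### Reduction of a corona to its pair counts. -/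

section Corona

variable {ι : Type*} {N : Finset ι} {size : ι → Size} {next : ι → ι}

theorem sum_eq_pairCount {R : Type*} [CommSemiring R] (g : Size → Size → R) :
    ∑ x ∈ N, g (size x) (size (next x)) =
      pairCount N size next .one .one * g .one .one + pairCount N size next .one .r * g .one .r +
      pairCount N size next .one .s * g .one .s + pairCount N size next .r .one * g .r .one +
      pairCount N size next .r .r * g .r .r + pairCount N size next .r .s * g .r .s +
      pairCount N size next .s .one * g .s .one + pairCount N size next .s .r * g .s .r +
      pairCount N size next .s .s * g .s .s := by
  classical
  simp only [pairCount, card_filter, Nat.cast_sum, sum_mul, ← sum_add_distrib]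
  refine sum_congr rfl fun x _ => ?_
  cases size x <;> cases size (next x) <;> simp

/-- `next` permutes `N`, so each size occurs equally often as first and as second member of a pair.
The parity conditions of the finite checks follow. -/
theorem pairCount_balance (hmaps : ∀ x ∈ N, next x ∈ N) (hinj : Set.InjOn next N) (a : Size) :
    pairCount N size next a .one + pairCount N size next a .r + pairCount N size next a .s =
      pairCount N size next .one a + pairCount N size next .r a + pairCount N size next .s a := by
  classical
  have himage : N.image next = N :=
    eq_of_subset_of_card_le (fun y hy => by
      obtain ⟨x, hx, rfl⟩ := mem_image.1 hy
      exact hmaps x hx) (card_image_of_injOn hinj).ge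
  have h : ∑ x ∈ N, (if size x = a then 1 else 0) =
      ∑ x ∈ N, (if size (next x) = a then 1 else 0) := by
    rw [← sum_image (f := fun y => if size y = a then 1 else 0) hinj, himage]
  have h1 := sum_eq_pairCount (N := N) (size := size) (next := next)
    (fun x _ => if x = a then 1 else 0)
  have h2 := sum_eq_pairCount (N := N) (size := size) (next := next)
    (fun _ y => if y = a then 1 else 0)
  rw [h1, h2] at h
  cases a <;> simp at h <;> omega

/-- The second circle of the only `rr` pair must itself be followed by an `r`, so it starts that
same pair and is its own successor. -/
theorem not_isolated_pair (hmaps : ∀ x ∈ N, next x ∈ N) (hne : ∀ x ∈ N, next x ≠ x)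
    (h : pairCount N size next .r .r = 1) (h1 : pairCount N size next .r .one = 0)
    (h2 : pairCount N size next .r .s = 0) : False := by
  classical
  unfold pairCount at h h1 h2
  obtain ⟨x, hx⟩ := card_eq_one.1 h
  rw [card_eq_zero, filter_eq_empty_iff] at h1 h2
  have hxm : x ∈ ({x ∈ N | size x = .r ∧ size (next x) = .r} : Finset ι) := by simp [hx]
  rw [mem_filter] at hxm
  obtain ⟨hxN, -, hxr⟩ := hxm
  have hyN := hmaps x hxN
  have hy : size (next (next x)) = .r := by
    have a1 := h1 hyN
    have a2 := h2 hyN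
    cases hs : size (next (next x)) <;> simp_all
  have : next x ∈ ({x ∈ N | size x = .r ∧ size (next x) = .r} : Finset ι) := by
    simp [hyN, hxr, hy]
  rw [hx, mem_singleton] at this
  exact hne x hxN this

/-- It is irrelevant whether `next` has one cycle or several: only the balance of the counts and the
absence of fixed points matter. -/
theorem corona_trichotomy (hmaps : ∀ x ∈ N, next x ∈ N) (hinj : Set.InjOn next N)
    (hne : ∀ x ∈ N, next x ≠ x) (q : Size) :
    0 ≤ ∑ x ∈ N, tightPotential (size x) q (size (next x)) ∨
      outerTurn q ≤ ∑ x ∈ N, outerWeight (size x) q (size (next x)) ∨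
      ∑ x ∈ N, innerWeight (size x) q (size (next x)) ≤ innerTurn q := by
  have b1 := pairCount_balance (size := size) hmaps hinj .one
  have b2 := pairCount_balance (size := size) hmaps hinj .r
  have b3 := pairCount_balance (size := size) hmaps hinj .s
  have hiso := not_isolated_pair (size := size) hmaps hne
  have e0 := sum_eq_pairCount (N := N) (size := size) (next := next) fun x y => tightPotential x q y
  have e1 := sum_eq_pairCount (N := N) (size := size) (next := next) fun x y => outerWeight x q y
  have e2 := sum_eq_pairCount (N := N) (size := size) (next := next) fun x y => innerWeight x q y
  rw [e0, e1, e2]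
  clear e0 e1 e2
  generalize pairCount N size next .one .one = n11 at *
  generalize pairCount N size next .one .r = n1r at *
  generalize pairCount N size next .one .s = n1s at *
  generalize pairCount N size next .r .one = nr1 at *
  generalize pairCount N size next .r .r = nrr at *
  generalize pairCount N size next .r .s = nrs at *
  generalize pairCount N size next .s .one = ns1 at *
  generalize pairCount N size next .s .r = nsr at *
  generalize pairCount N size next .s .s = nss at *
  have h111 := tightExcess_one_one_one_mem.1
  have h11r := tightExcess_one_one_r_mem.1
  have h11s := tightExcess_one_one_s_mem.2
  have hrr1 := tightExcess_r_r_one_mem.1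
  have hrrr := tightExcess_r_r_r_mem.1
  have hrrs := tightExcess_r_r_s_mem.1
  have hssr := tightExcess_s_s_r_mem.1
  have hsss := tightExcess_s_s_s_mem.1
  by_contra! hcon
  obtain ⟨hS, hB, hA⟩ := hcon
  cases q <;> simp only [outerTurn, innerTurn, outerWeight, innerWeight, Nat.cast_id] at hA hB
  -- The range bounds come from `hB`, the negated second alternative; the parities come from the
  -- balance equations.
  · have hc := corona_check_one n11 (by omega) (n1r + nr1) (by omega) (n1s + ns1) (by omega)
      (by omega) nrr (by omega) (nrs + nsr) (by omega) (by omega) nss (by omega)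
    rcases hc with hc | hc | hc
    · refine hS.not_ge ?_
      have hc' : 2 * ((n1s : ℝ) + ns1) ≤ nrs + nsr := by exact_mod_cast hc
      simp only [tightPotential]
      -- The `1s` and `rs` pairs together contribute `(2c - e) / 4` times the negative excess of
      -- `11s`.
      have := mul_nonneg_of_nonpos_of_nonpos (sub_nonpos.2 hc')
        (show tightExcess .one .one .s ≤ 0 by linarith)
      have := mul_nonneg (Nat.cast_nonneg (α := ℝ) n11)
        (show 0 ≤ tightExcess .one .one .one by linarith)
      have := mul_nonneg (Nat.cast_nonneg (α := ℝ) (n1r + nr1))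
        (show 0 ≤ tightExcess .one .one .r by linarith)
      push_cast at this
      linarith
    · omega
    · omega
  · have hc := corona_check_r n11 (by omega) (n1r + nr1) (by omega) (n1s + ns1) (by omega)
      (by omega) nrr (by omega) (nrs + nsr) (by omega) (by omega) nss (by omega)
    rcases hc with hc | hc | hc | hc
    · refine hS.not_ge ?_
      have hc' : (n1s : ℝ) + ns1 ≤ 2 * (n1r + nr1) := by exact_mod_cast hc
      simp only [tightPotential]
      have := mul_nonneg (sub_nonneg.2 hc')
        (show 0 ≤ tightExcess .r .r .one by linarith)
      have := mul_nonneg (Nat.cast_nonneg (α := ℝ) nrr)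
        (show 0 ≤ tightExcess .r .r .r by linarith)
      have := mul_nonneg (Nat.cast_nonneg (α := ℝ) (nrs + nsr))
        (show 0 ≤ tightExcess .r .r .s by linarith)
      push_cast at this
      linarith
    · exact hiso (by omega) (by omega) (by omega)
    · omega
    · omega
  · have hc := corona_check_s n11 (by omega) (n1r + nr1) (by omega) (n1s + ns1) (by omega)
      (by omega) nrr (by omega) (nrs + nsr) (by omega) (by omega) nss (by omega)
    rcases hc with hc | hc | hc
    · refine hS.not_ge ?_
      obtain ⟨rfl, rfl⟩ : n1s = 0 ∧ ns1 = 0 := by omega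
      simp only [tightPotential]
      have := mul_nonneg (Nat.cast_nonneg (α := ℝ) nss)
        (show 0 ≤ tightExcess .s .s .s by linarith)
      have := mul_nonneg (Nat.cast_nonneg (α := ℝ) (nrs + nsr))
        (show 0 ≤ tightExcess .s .s .r by linarith)
      push_cast at this ⊢
      linarith
    · omega
    · omega

theorem minSlope_nonneg (q : Size) : 0 ≤ minSlope q := by
  cases q <;> norm_num [minSlope]

/-- The potentials of a corona dominate its angular defect. -/
theorem corona_nonneg (hmaps : ∀ x ∈ N, next x ∈ N) (hinj : Set.InjOn next N)
    (hne : ∀ x ∈ N, next x ≠ x) (q : Size) :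
    0 ≤ ∑ x ∈ N, tightPotential (size x) q (size (next x)) +
      minSlope q * |2 * Real.pi - ∑ x ∈ N, tightAngle (size x) q (size (next x))| := by
  have hq := minSlope_nonneg q
  have habs := abs_nonneg (2 * Real.pi - ∑ x ∈ N, tightAngle (size x) q (size (next x)))
  rcases corona_trichotomy (size := size) hmaps hinj hne q with h | h | h
  · positivity
  · have h1 := sum_le_sum fun x (_ : x ∈ N) => outerWeight_le (size x) q (size (next x))
    rw [← mul_sum, sum_add_distrib, ← mul_sum] at h1
    have h2 : (outerTurn q : ℝ) ≤ ∑ x ∈ N, (outerWeight (size x) q (size (next x)) : ℝ) := by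
      exact_mod_cast h
    have h3 := le_outerTurn q
    have h4 := mul_le_mul_of_nonneg_left
      (neg_le_abs (2 * Real.pi - ∑ x ∈ N, tightAngle (size x) q (size (next x)))) hq
    linarith
  · have h1 := sum_le_sum fun x (_ : x ∈ N) => le_innerWeight (size x) q (size (next x))
    rw [← mul_sum, sum_sub_distrib, ← mul_sum] at h1
    have h2 : ∑ x ∈ N, (innerWeight (size x) q (size (next x)) : ℝ) ≤ innerTurn q := by
      exact_mod_cast h
    have h3 := innerTurn_le q
    have h4 := mul_le_mul_of_nonneg_left
      (le_abs_self (2 * Real.pi - ∑ x ∈ N, tightAngle (size x) q (size (next x)))) hq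
    linarith

end Corona

/-! ### The cross product of the plane -/

/-- The cross product of two vectors of the plane. -/
def cross (a b : Plane) : ℝ := a 0 * b 1 - a 1 * b 0

theorem cross_self (a : Plane) : cross a a = 0 := by
  unfold cross
  ring

theorem cross_comm (a b : Plane) : cross a b = -cross b a := by
  unfold cross
  ring

theorem cross_zero_left (a : Plane) : cross 0 a = 0 := by
  simp [cross]

theorem cross_zero_right (a : Plane) : cross a 0 = 0 := by
  simp [cross]

theorem cross_add_left (a b c : Plane) : cross (a + b) c = cross a c + cross b c := by
  simp only [cross, PiLp.add_apply]
  ring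

theorem cross_add_right (a b c : Plane) : cross a (b + c) = cross a b + cross a c := by
  simp only [cross, PiLp.add_apply]
  ring

theorem cross_smul_left (t : ℝ) (a b : Plane) : cross (t • a) b = t * cross a b := by
  simp only [cross, PiLp.smul_apply, smul_eq_mul]
  ring

theorem cross_smul_right (t : ℝ) (a b : Plane) : cross a (t • b) = t * cross a b := by
  simp only [cross, PiLp.smul_apply, smul_eq_mul]
  ring

theorem ne_of_cross_sub_pos {v x y : Plane} (h : 0 < cross (x - v) (y - v)) :
    x ≠ v ∧ y ≠ v ∧ x ≠ y := by
  refine ⟨?_, ?_, ?_⟩ <;> rintro rfl <;>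
    simp [cross_self, cross_zero_left, cross_zero_right] at h

theorem sq_add_sq_pos {a : Plane} (ha : a ≠ 0) : 0 < a 0 ^ 2 + a 1 ^ 2 := by
  by_contra! h
  refine ha (PiLp.ext fun i => ?_)
  fin_cases i <;> simp <;> nlinarith [sq_nonneg (a 0), sq_nonneg (a 1)]

theorem exists_smul_eq_of_cross_eq_zero {a b : Plane} (ha : a ≠ 0) (h : cross a b = 0) :
    ∃ c : ℝ, b = c • a := by
  have hpos := sq_add_sq_pos ha
  unfold cross at h
  refine ⟨(a 0 * b 0 + a 1 * b 1) / (a 0 ^ 2 + a 1 ^ 2), PiLp.ext fun i => ?_⟩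
  rw [PiLp.smul_apply, smul_eq_mul, div_mul_eq_mul_div, eq_div_iff hpos.ne']
  fin_cases i <;> simp only [Fin.zero_eta, Fin.mk_one]
  · linear_combination (-a 1) * h
  · linear_combination a 0 * h

/-- The rotation of the plane by a right angle. -/
def rot (u : Plane) : Plane := !₂[-u 1, u 0]

theorem cross_rot_self (u : Plane) : cross (rot u) u = -(u 0 ^ 2 + u 1 ^ 2) := by
  simp [cross, rot]
  ring

/-! ### Convex hulls of segments and triangles -/

theorem cross_convexComb_right (c v a b : Plane) {s t : ℝ} (h : s + t = 1) :
    cross c (s • a + t • b - v) = s * cross c (a - v) + t * cross c (b - v) := by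
  obtain rfl : t = 1 - s := by linarith
  simp only [cross, PiLp.add_apply, PiLp.sub_apply, PiLp.smul_apply, smul_eq_mul]
  ring

theorem cross_convexComb_left (c v a b : Plane) {s t : ℝ} (h : s + t = 1) :
    cross (s • a + t • b - v) c = s * cross (a - v) c + t * cross (b - v) c := by
  rw [cross_comm, cross_convexComb_right c v a b h, cross_comm (a - v), cross_comm (b - v)]
  ring

theorem cross_eq_zero_of_mem_convexHull_pair {v x p : Plane}
    (hp : p ∈ convexHull ℝ ({v, x} : Set Plane)) : cross (x - v) (p - v) = 0 := by
  have hc : Convex ℝ {p : Plane | cross (x - v) (p - v) = 0} := by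
    intro a ha b hb s t _ _ hst
    rw [Set.mem_ofPred_eq] at *
    rw [cross_convexComb_right _ _ _ _ hst, ha, hb]
    ring
  refine convexHull_min ?_ hc hp
  rintro z (rfl | rfl)
  · simp [cross_zero_right]
  · simp [cross_self]

theorem cross_nonneg_of_mem_convexHull {v x y p : Plane} (h : 0 < cross (x - v) (y - v))
    (hp : p ∈ convexHull ℝ ({v, x, y} : Set Plane)) :
    0 ≤ cross (x - v) (p - v) ∧ 0 ≤ cross (p - v) (y - v) := by
  have hc : Convex ℝ {p : Plane | 0 ≤ cross (x - v) (p - v) ∧ 0 ≤ cross (p - v) (y - v)} := by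
    intro a ha b hb s t hs ht hst
    rw [Set.mem_ofPred_eq] at *
    rw [cross_convexComb_right _ _ _ _ hst, cross_convexComb_left _ _ _ _ hst]
    exact ⟨add_nonneg (mul_nonneg hs ha.1) (mul_nonneg ht hb.1),
      add_nonneg (mul_nonneg hs ha.2) (mul_nonneg ht hb.2)⟩
  refine convexHull_min ?_ hc hp
  rintro z (rfl | rfl | rfl)
  · simp [cross_zero_left, cross_zero_right]
  · simp [cross_self, h.le]
  · simp [cross_self, h.le]

theorem eventually_pos_add_mul {p : ℝ} (hp : 0 < p) (q : ℝ) :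
    ∀ᶠ t in 𝓝[>] (0 : ℝ), 0 < p + t * q := by
  have h : Tendsto (fun t : ℝ => p + t * q) (𝓝 0) (𝓝 (p + 0 * q)) :=
    Continuous.tendsto (by fun_prop) 0
  rw [zero_mul, add_zero] at h
  exact (h.mono_left nhdsWithin_le_nhds).eventually (lt_mem_nhds hp)

/-- Cramer's rule gives `u` nonnegative coordinates `α`, `β` along the two edges at `v`; then `1 -
t(α + β)`, `tα`, `tβ` are barycentric coordinates once `t` is small. -/
theorem eventually_mem_convexHull {v x y u : Plane} (h : 0 < cross (x - v) (y - v))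
    (h1 : 0 ≤ cross (x - v) u) (h2 : 0 ≤ cross u (y - v)) :
    ∀ᶠ t in 𝓝[>] (0 : ℝ), v + t • u ∈ convexHull ℝ ({v, x, y} : Set Plane) := by
  set D := cross (x - v) (y - v) with hD
  have hu : u = (cross u (y - v) / D) • (x - v) + (cross (x - v) u / D) • (y - v) := by
    refine PiLp.ext fun i => ?_
    rw [PiLp.add_apply, PiLp.smul_apply, PiLp.smul_apply, smul_eq_mul, smul_eq_mul,
      div_mul_eq_mul_div, div_mul_eq_mul_div, ← add_div, eq_div_iff h.ne', hD]
    unfold cross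
    fin_cases i <;> simp only [Fin.zero_eta, Fin.mk_one] <;> ring
  have hα : 0 ≤ cross u (y - v) / D := by positivity
  have hβ : 0 ≤ cross (x - v) u / D := by positivity
  generalize cross u (y - v) / D = α at *
  generalize cross (x - v) u / D = β at *
  filter_upwards [eventually_pos_add_mul one_pos (-(α + β)), self_mem_nhdsWithin] with t ht ht0
  have ht0 : 0 < t := ht0
  have hmem : ∑ i : Fin 3, ![1 - t * (α + β), t * α, t * β] i • ![v, x, y] i ∈
      convexHull ℝ ({v, x, y} : Set Plane) := by
    refine (convex_convexHull ℝ _).sum_mem (fun i _ => ?_) ?_ (fun i _ => ?_)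
    · fin_cases i <;> simp
      · linarith
      · positivity
      · positivity
    · simp [Fin.sum_univ_three]
      ring
    · fin_cases i <;> apply subset_convexHull <;> simp
  convert hmem using 1
  rw [hu]
  simp only [Fin.sum_univ_three, Matrix.cons_val_zero, Matrix.cons_val_one, Matrix.cons_val]
  module

/-! ### The triangles around a vertex of a simplicial complex -/

section Star

variable {K : Geometry.SimplicialComplex ℝ Plane} {v : Plane}

open Classical in
/-- `v`, `x`, `y` are the vertices of a triangle of `K`, in counterclockwise order. -/
def IsCorner (K : Geometry.SimplicialComplex ℝ Plane) (v x y : Plane) : Prop :=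
  {v, x, y} ∈ K.faces ∧ 0 < cross (x - v) (y - v)

theorem IsCorner.inter_subset {x y x' y' p : Plane} (h : IsCorner K v x y)
    (h' : IsCorner K v x' y') (hp : p ∈ convexHull ℝ ({v, x, y} : Set Plane))
    (hp' : p ∈ convexHull ℝ ({v, x', y'} : Set Plane)) :
    p ∈ convexHull ℝ (({v, x, y} : Set Plane) ∩ {v, x', y'}) := by
  classical
  have := K.inter_subset_convexHull h.1 h'.1 (a := p)
  simp only [coe_insert, coe_singleton] at this
  exact this ⟨hp, hp'⟩

/-- Triangles around `v` whose interiors meet near `v` coincide. -/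
theorem IsCorner.eq_of_overlap {x y x' y' u : Plane} (h : IsCorner K v x y)
    (h' : IsCorner K v x' y') (h1 : 0 < cross (x - v) u) (h2 : 0 < cross u (y - v))
    (h1' : 0 < cross (x' - v) u) (h2' : 0 < cross u (y' - v)) : x = x' ∧ y = y' := by
  -- A point close to `v` in direction `u` is in both triangles, hence in the hull of their common
  -- vertices. If `x` or `y` were not common, it would lie on an edge line through `v`, against the
  -- strict signs.
  obtain ⟨t, ⟨hp, hp'⟩, ht⟩ := (((eventually_mem_convexHull h.2 h1.le h2.le).and
    (eventually_mem_convexHull h'.2 h1'.le h2'.le)).and self_mem_nhdsWithin).exists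
  have ht : 0 < t := ht
  have hp := h.inter_subset h' hp hp'
  obtain ⟨nx, ny, nxy⟩ := ne_of_cross_sub_pos h.2
  have hx : x ∈ ({v, x', y'} : Set Plane) := by
    by_contra hx
    have hs : ({v, x, y} : Set Plane) ∩ {v, x', y'} ⊆ {v, y} := by
      rintro z ⟨rfl | rfl | rfl, hz⟩
      · simp
      · exact absurd hz hx
      · simp
    have := cross_eq_zero_of_mem_convexHull_pair (convexHull_mono hs hp)
    rw [add_sub_cancel_left, cross_smul_right, cross_comm] at this
    nlinarith
  have hy : y ∈ ({v, x', y'} : Set Plane) := by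
    by_contra hy
    have hs : ({v, x, y} : Set Plane) ∩ {v, x', y'} ⊆ {v, x} := by
      rintro z ⟨rfl | rfl | rfl, hz⟩
      · simp
      · simp
      · exact absurd hz hy
    have := cross_eq_zero_of_mem_convexHull_pair (convexHull_mono hs hp)
    rw [add_sub_cancel_left, cross_smul_right] at this
    nlinarith
  have hD := h.2
  have hD' := h'.2
  rcases hx with hx | hx | hx <;> rcases hy with hy | hy | hy
  · exact absurd hx nx
  · exact absurd hx nx
  · exact absurd hx nx
  · exact absurd hy ny
  · exact absurd (hx.trans hy.symm) nxy
  · exact ⟨hx, hy⟩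
  · exact absurd hy ny
  · rw [hx, hy, cross_comm] at hD
    linarith
  · exact absurd (hx.trans hy.symm) nxy

/-- Two triangles on the same side of the edge `vx` overlap in the directions just beyond that of
`x`. -/
theorem IsCorner.right_unique {x y y' : Plane} (h : IsCorner K v x y) (h' : IsCorner K v x y') :
    y = y' := by
  obtain ⟨t, ⟨h1, h2⟩, ht⟩ := (((eventually_pos_add_mul h.2 (cross (y' - v) (y - v))).and
    (eventually_pos_add_mul h'.2 (cross (y - v) (y' - v)))).and self_mem_nhdsWithin).exists
  have ht : 0 < t := ht
  have hD := h.2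
  have hD' := h'.2
  have h3 : 0 < t * (cross (x - v) (y - v) + cross (x - v) (y' - v)) := by positivity
  refine (h.eq_of_overlap h' (u := (x - v) + t • ((y - v) + (y' - v))) ?_ ?_ ?_ ?_).2 <;>
    simp only [cross_add_left, cross_add_right, cross_smul_left, cross_smul_right, cross_self] <;>
    linarith

theorem IsCorner.left_unique {x x' y : Plane} (h : IsCorner K v x y) (h' : IsCorner K v x' y) :
    x = x' := by
  obtain ⟨t, ⟨h1, h2⟩, ht⟩ := (((eventually_pos_add_mul h.2 (cross (x - v) (x' - v))).and
    (eventually_pos_add_mul h'.2 (cross (x' - v) (x - v)))).and self_mem_nhdsWithin).exists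
  have ht : 0 < t := ht
  have hD := h.2
  have hD' := h'.2
  have h3 : 0 < t * (cross (x - v) (y - v) + cross (x' - v) (y - v)) := by positivity
  refine (h.eq_of_overlap h' (u := (y - v) + t • ((x - v) + (x' - v))) ?_ ?_ ?_ ?_).1 <;>
    simp only [cross_add_left, cross_add_right, cross_smul_left, cross_smul_right, cross_self] <;>
    linarith

/-- At most one triangle around `v` contains the leftward direction in its half-open sector. -/
theorem IsCorner.crossing_unique {x y x' y' : Plane} (h : IsCorner K v x y)
    (h' : IsCorner K v x' y') (hx : 0 ≤ (x - v) 1) (hy : (y - v) 1 < 0) (hx' : 0 ≤ (x' - v) 1)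
    (hy' : (y' - v) 1 < 0) : x = x' := by
  -- The test direction `(-1, -t)` lies just counterclockwise of leftward, strictly inside the
  -- sector even when its first side points exactly left.
  have key : ∀ a b : Plane, 0 < cross a b → 0 ≤ a 1 → b 1 < 0 →
      ∀ᶠ t in 𝓝[>] (0 : ℝ), 0 < cross a !₂[-1, -t] ∧ 0 < cross !₂[-1, -t] b := by
    intro a b hD ha hb
    unfold cross at hD
    have h2 := eventually_pos_add_mul (neg_pos.2 hb) (b 0)
    have h1 : ∀ᶠ t in 𝓝[>] (0 : ℝ), 0 < a 1 + t * (-a 0) := by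
      rcases ha.eq_or_lt with ha | ha
      · have ha0 : a 0 < 0 := by
          rw [← ha] at hD
          nlinarith
        filter_upwards [self_mem_nhdsWithin] with t ht
        have ht : 0 < t := ht
        rw [← ha]
        nlinarith
      · exact eventually_pos_add_mul ha _
    filter_upwards [h1, h2] with t h1 h2
    constructor <;> simp [cross] <;> linarith
  obtain ⟨t, h1, h2⟩ := ((key _ _ h.2 hx hy).and (key _ _ h'.2 hx' hy')).exists
  exact (h.eq_of_overlap h' h1.1 h1.2 h2.1 h2.2).1

/-- A neighbor of `v` inside the sector of a triangle around `v` is a vertex of that triangle. -/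
theorem IsCorner.eq_left_of_mem {a b x y : Plane} (h : IsCorner K v a b) (h' : IsCorner K v x y)
    (h1 : 0 ≤ cross (a - v) (y - v)) (h2 : 0 < cross (y - v) (b - v)) : y = a := by
  classical
  obtain ⟨t, ⟨hp, ht⟩, ht1⟩ := (((eventually_mem_convexHull h.2 h1 h2.le).and
    self_mem_nhdsWithin).and (eventually_pos_add_mul one_pos (-1))).exists
  have ht : 0 < t := ht
  obtain ⟨-, ny, -⟩ := ne_of_cross_sub_pos h'.2
  have hf : ({v, y} : Finset Plane) ∈ K.faces :=
    K.down_closed h'.1 (by intro z; simp; tauto) (by simp)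
  have hp' : v + t • (y - v) ∈ convexHull ℝ ({v, y} : Set Plane) := by
    rw [convexHull_pair, segment_eq_image']
    exact ⟨t, ⟨ht.le, by linarith⟩, rfl⟩
  have hp := K.inter_subset_convexHull h.1 hf (a := v + t • (y - v))
    (by simp only [coe_insert, coe_singleton]; exact ⟨hp, hp'⟩)
  simp only [coe_insert, coe_singleton] at hp
  have hy : y ∈ ({v, a, b} : Set Plane) := by
    by_contra hy
    have hs : ({v, a, b} : Set Plane) ∩ {v, y} ⊆ {v} := by
      rintro z ⟨hz, rfl | rfl⟩
      · simp
      · exact absurd hz hy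
    have := convexHull_mono hs hp
    rw [convexHull_singleton, Set.mem_singleton_iff, add_eq_left, smul_eq_zero, sub_eq_zero] at this
    exact this.elim ht.ne' ny
  rcases hy with hy | hy | hy
  · exact absurd hy ny
  · exact hy
  · rw [Set.mem_singleton_iff.1 hy, cross_self] at h2
    exact absurd h2 (lt_irrefl _)

theorem cross_sub_ne_zero_of_mem_faces {T : Finset Plane} (hT : T ∈ K.faces) {x y : Plane}
    (hv : v ∈ T) (hx : x ∈ T) (hy : y ∈ T) (hxv : x ≠ v) (hyv : y ≠ v) (hxy : x ≠ y) :
    cross (x - v) (y - v) ≠ 0 := by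
  intro h
  obtain ⟨c, hc⟩ := exists_smul_eq_of_cross_eq_zero (sub_ne_zero.2 hxv) h
  have hinj : Function.Injective (![⟨v, hv⟩, ⟨x, hx⟩, ⟨y, hy⟩] : Fin 3 → T) := by
    intro i j hij
    fin_cases i <;> fin_cases j <;> simp_all [eq_comm]
  have hi := (K.indep hT).comp_embedding ⟨_, hinj⟩
  have he : (fun z : T => (z : Plane)) ∘ (⟨_, hinj⟩ : Fin 3 ↪ T) = ![v, x, y] := by
    funext i
    fin_cases i <;> rfl
  rw [he, affineIndependent_iff_not_collinear_set] at hi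
  refine hi ((collinear_iff_of_mem (p₀ := v) (by simp)).2 ⟨x - v, ?_⟩)
  rintro z (rfl | rfl | rfl)
  · exact ⟨0, by simp⟩
  · exact ⟨1, by simp⟩
  · exact ⟨c, by rw [← hc]; simp⟩

open Classical in
theorem exists_isCorner {T : Finset Plane} (hT : T ∈ K.faces) (hcard : T.card = 3) (hv : v ∈ T) :
    ∃ x y, T = {v, x, y} ∧ IsCorner K v x y := by
  have h2 : (T.erase v).card = 2 := by rw [card_erase_of_mem hv, hcard]
  obtain ⟨x, y, hxy, he⟩ := card_eq_two.1 h2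
  have hTe : T = {v, x, y} := by rw [← insert_erase hv, he]
  have hx : x ∈ T.erase v := by simp [he]
  have hy : y ∈ T.erase v := by simp [he]
  rw [mem_erase] at hx hy
  rcases (cross_sub_ne_zero_of_mem_faces hT hv hx.2 hy.2 hx.1 hy.1 hxy).lt_or_gt with h | h
  · have hTe' : T = {v, y, x} := by rw [hTe, pair_comm x y]
    refine ⟨y, x, hTe', hTe' ▸ hT, ?_⟩
    rw [cross_comm]
    linarith
  · exact ⟨x, y, hTe, hTe ▸ hT, h⟩

theorem IsCorner.card {x y : Plane} (h : IsCorner K v x y) [DecidableEq Plane] :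
    ({v, x, y} : Finset Plane).card = 3 := by
  obtain ⟨nx, ny, nxy⟩ := ne_of_cross_sub_pos h.2
  exact card_eq_three.2 ⟨v, x, y, nx.symm, ny.symm, nxy, rfl⟩

/-- If finitely many triangles around `v` cover a neighborhood of `v`, then each direction is in
the half-open sector of one of them. -/
theorem exists_isCorner_of_direction (hfin : {T ∈ K.faces | T.card = 3 ∧ v ∈ T}.Finite)
    (hcover : ∀ᶠ p in 𝓝 v, ∃ T ∈ K.faces, T.card = 3 ∧ v ∈ T ∧ p ∈ convexHull ℝ (T : Set Plane))
    {u : Plane} (hu : u ≠ 0) :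
    ∃ x y, IsCorner K v x y ∧ 0 ≤ cross (x - v) u ∧ 0 < cross u (y - v) := by
  classical
  by_contra! hcon
  -- If no half-open sector contains `u`, each triangle is missed by the ray obtained by turning `u`
  -- slightly counterclockwise. Strict failures persist for small `ε`; the only other case is `u`
  -- along the second side, where turning leaves the triangle.
  have hT : ∀ T ∈ {T ∈ K.faces | T.card = 3 ∧ v ∈ T}, ∀ᶠ ε in 𝓝[>] (0 : ℝ), ∀ t : ℝ, 0 < t →
      v + t • (u + ε • rot u) ∉ convexHull ℝ (T : Set Plane) := by
    rintro T ⟨hTK, hcard, hvT⟩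
    obtain ⟨x, y, rfl, h⟩ := exists_isCorner hTK hcard hvT
    have hmem : ∀ ε t : ℝ, 0 < t →
        v + t • (u + ε • rot u) ∈ convexHull ℝ (({v, x, y} : Finset Plane) : Set Plane) →
        0 ≤ cross (x - v) u + ε * cross (x - v) (rot u) ∧
          0 ≤ cross u (y - v) + ε * cross (rot u) (y - v) := by
      intro ε t ht hp
      rw [coe_insert, coe_insert, coe_singleton] at hp
      have := cross_nonneg_of_mem_convexHull h.2 hp
      rw [add_sub_cancel_left, cross_smul_left, cross_smul_right, cross_add_left, cross_add_right,
        cross_smul_left, cross_smul_right] at this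
      exact ⟨nonneg_of_mul_nonneg_right this.1 ht, nonneg_of_mul_nonneg_right this.2 ht⟩
    rcases lt_or_ge (cross (x - v) u) 0 with h1 | h1
    · filter_upwards [eventually_pos_add_mul (neg_pos.2 h1) (-cross (x - v) (rot u))]
        with ε hε t ht hp
      linarith [(hmem ε t ht hp).1]
    rcases (hcon x y h h1).lt_or_eq with h2 | h2
    · filter_upwards [eventually_pos_add_mul (neg_pos.2 h2) (-cross (rot u) (y - v))]
        with ε hε t ht hp
      linarith [(hmem ε t ht hp).2]
    · obtain ⟨c, hc⟩ := exists_smul_eq_of_cross_eq_zero hu h2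
      have hD := h.2
      rw [hc, cross_smul_right] at hD
      have hc0 : 0 < c := pos_of_mul_pos_left hD h1
      filter_upwards [self_mem_nhdsWithin] with ε hε t ht hp
      have hε : 0 < ε := hε
      have := (hmem ε t ht hp).2
      rw [h2, hc, cross_smul_right, cross_rot_self] at this
      have := mul_pos hε (mul_pos hc0 (sq_add_sq_pos hu))
      linarith
  -- By finiteness one `ε` serves all triangles, and that ray contradicts the covering near `v`.
  obtain ⟨ε, hε⟩ := ((eventually_all_finite hfin).2 hT).exists
  have hlim : Tendsto (fun t : ℝ => v + t • (u + ε • rot u)) (𝓝[>] 0) (𝓝 v) := by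
    have : Tendsto (fun t : ℝ => v + t • (u + ε • rot u)) (𝓝 0)
        (𝓝 (v + (0 : ℝ) • (u + ε • rot u))) := Continuous.tendsto (by fun_prop) 0
    rw [zero_smul, add_zero] at this
    exact this.mono_left nhdsWithin_le_nhds
  obtain ⟨t, ⟨T, hTK, hcard, hvT, hp⟩, ht⟩ :=
    ((hlim.eventually hcover).and self_mem_nhdsWithin).exists
  exact hε T ⟨hTK, hcard, hvT⟩ t ht hp

end Star

/-! ### Angles -/

/-- The argument of a vector of the plane. -/
def planeArg (a : Plane) : ℝ := Complex.arg ⟨a 0, a 1⟩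

/-- The difference of the arguments has the cosine of the angle and a positive sine, so it lies in
`(0, π)` or in `(-2π, -π)`. The latter happens exactly when the branch cut is crossed, which the
signs of the second coordinates detect. -/
theorem angle_eq_planeArg_sub {a b : Plane} (h : 0 < cross a b) :
    InnerProductGeometry.angle a b =
      planeArg b - planeArg a + if 0 ≤ a 1 ∧ b 1 < 0 then 2 * Real.pi else 0 := by
  have hnorm : ∀ c : Plane, ‖(⟨c 0, c 1⟩ : ℂ)‖ = ‖c‖ := by
    intro c
    rw [EuclideanSpace.norm_eq, Complex.norm_def, Complex.normSq_mk]
    simp [Fin.sum_univ_two, sq]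
  have ha : a ≠ 0 := by
    rintro rfl
    simp [cross_zero_left] at h
  have hb : b ≠ 0 := by
    rintro rfl
    simp [cross_zero_right] at h
  have hna : 0 < ‖a‖ := norm_pos_iff.2 ha
  have hnb : 0 < ‖b‖ := norm_pos_iff.2 hb
  have hne : ∀ c : Plane, c ≠ 0 → (⟨c 0, c 1⟩ : ℂ) ≠ 0 := by
    intro c hc h0
    rw [← norm_eq_zero, hnorm] at h0
    exact hc (norm_eq_zero.1 h0)
  have hcos : Real.cos (planeArg b - planeArg a) = inner ℝ a b / (‖a‖ * ‖b‖) := by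
    unfold planeArg
    rw [Real.cos_sub, Complex.cos_arg (hne b hb), Complex.cos_arg (hne a ha), Complex.sin_arg,
      Complex.sin_arg, hnorm, hnorm]
    simp only [PiLp.inner_apply, Fin.sum_univ_two]
    simp
    field_simp
  have hsin : 0 < Real.sin (planeArg b - planeArg a) := by
    have : Real.sin (planeArg b - planeArg a) = cross a b / (‖a‖ * ‖b‖) := by
      unfold planeArg cross
      rw [Real.sin_sub, Complex.cos_arg (hne b hb), Complex.cos_arg (hne a ha), Complex.sin_arg,
        Complex.sin_arg, hnorm, hnorm]
      simp
      field_simp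
    rw [this]
    positivity
  have a1 := Complex.neg_pi_lt_arg ⟨a 0, a 1⟩
  have a2 := Complex.arg_le_pi ⟨a 0, a 1⟩
  have b1 := Complex.neg_pi_lt_arg ⟨b 0, b 1⟩
  have b2 := Complex.arg_le_pi ⟨b 0, b 1⟩
  have a3 := Complex.arg_nonneg_iff (z := ⟨a 0, a 1⟩)
  have b3 := Complex.arg_neg_iff (z := ⟨b 0, b 1⟩)
  simp only at a3 b3
  simp only [← a3, ← b3]
  change -Real.pi < planeArg a at a1
  change planeArg a ≤ Real.pi at a2
  change -Real.pi < planeArg b at b1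
  change planeArg b ≤ Real.pi at b2
  change _ = planeArg b - planeArg a + if 0 ≤ planeArg a ∧ planeArg b < 0 then 2 * Real.pi else 0
  unfold InnerProductGeometry.angle
  rw [← hcos]
  rcases lt_or_ge 0 (planeArg b - planeArg a) with hθ | hθ
  · have hπ : planeArg b - planeArg a ≤ Real.pi := by
      by_contra! hπ
      have := Real.sin_nonneg_of_nonneg_of_le_pi (sub_nonneg.2 hπ.le) (by linarith)
      rw [Real.sin_sub_pi] at this
      linarith
    rw [if_neg (fun h => by linarith [h.1, h.2]), add_zero, Real.arccos_cos hθ.le hπ]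
  · have hπ : planeArg b - planeArg a < -Real.pi := by
      by_contra! hπ
      have := Real.sin_nonpos_of_nonpos_of_neg_pi_le hθ hπ
      linarith
    rw [if_pos ⟨by linarith, by linarith⟩, ← Real.cos_add_two_pi,
      Real.arccos_cos (by linarith) (by linarith)]

/-! ### The cycle of triangles around a vertex. -/

section Star

variable {K : Geometry.SimplicialComplex ℝ Plane} {v : Plane}

open Classical in
/-- The triangles around `v` form a cycle which winds once around `v`. -/
theorem exists_corona (hfin : {T ∈ K.faces | T.card = 3 ∧ v ∈ T}.Finite)
    (hcover : ∀ᶠ p in 𝓝 v, ∃ T ∈ K.faces, T.card = 3 ∧ v ∈ T ∧ p ∈ convexHull ℝ (T : Set Plane)) :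
    ∃ (N : Finset Plane) (next : Plane → Plane), (∀ x ∈ N, next x ∈ N) ∧ Set.InjOn next N ∧
      (∀ x ∈ N, IsCorner K v x (next x)) ∧
      Set.BijOn (fun x => ({v, x, next x} : Finset Plane)) N
        {T ∈ K.faces | T.card = 3 ∧ v ∈ T} ∧
      ∑ x ∈ N, EuclideanGeometry.angle x v (next x) = 2 * Real.pi := by
  have hNfin : {x | ∃ y, IsCorner K v x y}.Finite := by
    refine (hfin.biUnion fun T _ => T.finite_toSet).subset ?_
    rintro x ⟨y, h⟩
    exact Set.mem_biUnion (x := ({v, x, y} : Finset Plane)) ⟨h.1, h.card, by simp⟩ (by simp)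
  let N := hNfin.toFinset
  -- The value `x` off `N` is arbitrary.
  let next : Plane → Plane := fun x => if h : ∃ y, IsCorner K v x y then h.choose else x
  have hN : ∀ x, x ∈ N ↔ ∃ y, IsCorner K v x y := fun x => by simp [N]
  have hnext : ∀ x ∈ N, IsCorner K v x (next x) := by
    intro x hx
    rw [hN] at hx
    simp only [next, dif_pos hx]
    exact hx.choose_spec
  have hmaps : ∀ x ∈ N, next x ∈ N := by
    intro x hx
    have h := hnext x hx
    -- Some half-open sector contains the direction of `next x`; being a neighbor of `v`, `next x`
    -- must be the first side of that sector, so a triangle starts there.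
    obtain ⟨a, b, hab, h1, h2⟩ := exists_isCorner_of_direction hfin hcover
      (sub_ne_zero.2 (ne_of_cross_sub_pos h.2).2.1)
    rw [hab.eq_left_of_mem h h1 h2, hN]
    exact ⟨b, hab⟩
  have hinj : Set.InjOn next N := by
    intro x hx x' hx' he
    have h := hnext x hx
    rw [he] at h
    exact h.left_unique (hnext x' hx')
  refine ⟨N, next, hmaps, hinj, hnext, ⟨?_, ?_, ?_⟩, ?_⟩
  · intro x hx
    exact ⟨(hnext x hx).1, (hnext x hx).card, by simp⟩
  · intro x hx x' hx' he
    replace he : ({v, x, next x} : Finset Plane) = {v, x', next x'} := he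
    have h := hnext x hx
    have h' := hnext x' hx'
    obtain ⟨nx, ny, nxy⟩ := ne_of_cross_sub_pos h.2
    have hx1 : x ∈ ({v, x', next x'} : Finset Plane) := by
      rw [← he]
      simp
    have hy1 : next x ∈ ({v, x', next x'} : Finset Plane) := by
      rw [← he]
      simp
    simp only [mem_insert, mem_singleton, nx, ny, false_or] at hx1 hy1
    rcases hx1 with hx1 | hx1
    · exact hx1
    · rcases hy1 with hy1 | hy1
      · have hD := h.2
        have hD' := h'.2
        rw [hy1, cross_comm, hx1] at hD
        linarith
      · exact absurd (hx1.trans hy1.symm) nxy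
  · rintro T ⟨hT, hcard, hvT⟩
    obtain ⟨x, y, rfl, h⟩ := exists_isCorner hT hcard hvT
    have hx : x ∈ N := (hN x).2 ⟨y, h⟩
    exact ⟨x, hx, by simp only; rw [(hnext x hx).right_unique h]⟩
  -- Exactly one triangle crosses the branch cut of the argument; it supplies the whole `2π`.
  · have hcross : ∃! x, x ∈ N ∧ 0 ≤ (x - v) 1 ∧ (next x - v) 1 < 0 := by
      obtain ⟨x, y, h, h1, h2⟩ := exists_isCorner_of_direction hfin hcover (u := !₂[-1, 0])
        (fun h => by simpa using congrArg (fun w : Plane => w 0) h)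
      have hx : x ∈ N := (hN x).2 ⟨y, h⟩
      have hy : next x = y := (hnext x hx).right_unique h
      refine ⟨x, ⟨hx, ?_, ?_⟩, ?_⟩
      · simpa [cross] using h1
      · rw [hy]
        simpa [cross] using h2
      · rintro x' ⟨hx', h1', h2'⟩
        refine (hnext x' hx').crossing_unique h h1' h2' ?_ ?_
        · simpa [cross] using h1
        · simpa [cross] using h2
    obtain ⟨x₀, hx₀, huniq⟩ := hcross
    have hangle : ∀ x ∈ N, EuclideanGeometry.angle x v (next x) =
        planeArg (next x - v) - planeArg (x - v) + if x = x₀ then 2 * Real.pi else 0 := by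
      intro x hx
      refine (angle_eq_planeArg_sub (hnext x hx).2).trans ?_
      congr 1
      refine if_congr ⟨fun h => huniq x ⟨hx, h⟩, ?_⟩ rfl rfl
      rintro rfl
      exact hx₀.2
    have himage : N.image next = N :=
      eq_of_subset_of_card_le (fun y hy => by
        obtain ⟨x, hx, rfl⟩ := mem_image.1 hy
        exact hmaps x hx) (card_image_of_injOn hinj).ge
    have hsum : ∑ x ∈ N, planeArg (next x - v) = ∑ x ∈ N, planeArg (x - v) := by
      rw [← sum_image (f := fun y => planeArg (y - v)) hinj, himage]
    rw [sum_congr rfl hangle, sum_add_distrib, sum_sub_distrib, hsum, sub_self, zero_add,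
      sum_ite_eq' N x₀, if_pos hx₀.1]

end Star

/-! ### Local finiteness of FM-triangulations -/

theorem Size.radius_mem (x : Size) : x.radius ∈ Set.Icc (1 / 2 : ℝ) 1 := by
  refine ⟨le_trans ?_ (radiusLo_le x), (le_radiusHi x).trans ?_⟩ <;>
    cases x <;> norm_num [radiusLo, radiusHi]

namespace Packing

variable {P : Packing} {K : Geometry.SimplicialComplex ℝ Plane}

theorem finite_inter_closedBall (P : Packing) (v : Plane) (R : ℝ) :
    (Metric.closedBall v R ∩ P.centers).Finite := by
  have h : P.centers.Pairwise fun x y => (1 : ℝ) ≤ dist x y := fun x hx y hy hxy => by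
    have := P.interior_disjoint hx hy hxy
    linarith [(P.size x).radius_mem.1, (P.size y).radius_mem.1]
  have : DiscreteTopology P.centers := DiscreteTopology.of_forall_le_dist one_pos
    fun x y hxy => h x.2 y.2 (Subtype.coe_ne_coe.2 hxy)
  exact Metric.finite_isBounded_inter_isClosed DiscreteTopology.isDiscrete
    Metric.isBounded_closedBall (Metric.isClosed_of_pairwise_le_dist one_pos h)

/-- By saturation some circle is at signed distance less than `s` from `p`, hence so is the circle
at `c`, and `s` plus its radius is at most `2`. -/
theorem IsSaturated.dist_lt_two (hP : P.IsSaturated) {p c : Plane} (h : p ∈ P.cell c) :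
    dist p c < 2 := by
  unfold IsSaturated at hP
  push Not at hP
  obtain ⟨d, hd, hlt⟩ := hP p
  have := h d hd
  have h1 := Size.s.radius_mem.2
  have h2 := (P.size c).radius_mem.2
  linarith

theorem IsFMTriangulation.dist_lt_four (hK : P.IsFMTriangulation K) (hP : P.IsSaturated)
    {T : Finset Plane} (hT : T ∈ K.faces) (hcard : T.card = 3) {x y : Plane} (hx : x ∈ T)
    (hy : y ∈ T) : dist x y < 4 := by
  obtain ⟨p, hp⟩ := hK.dual T hT hcard
  have h1 := hP.dist_lt_two (hp x hx)
  have h2 := hP.dist_lt_two (hp y hy)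
  linarith [dist_triangle_left x y p]

theorem IsFMTriangulation.finite_triangles (hK : P.IsFMTriangulation K) (hP : P.IsSaturated)
    (v : Plane) (R : ℝ) :
    {T ∈ K.faces | T.card = 3 ∧ ∃ x ∈ T, dist x v ≤ R}.Finite := by
  refine ((P.finite_inter_closedBall v (4 + R)).toFinset.powerset.finite_toSet).subset ?_
  rintro T ⟨hT, hcard, x, hx, hxv⟩
  rw [mem_coe, mem_powerset]
  intro y hy
  rw [Set.Finite.mem_toFinset, ← hK.vertices_eq]
  refine ⟨?_, K.down_closed hT (singleton_subset_iff.2 hy) (singleton_nonempty y)⟩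
  rw [Metric.mem_closedBall]
  linarith [dist_triangle y x v, hK.dist_lt_four hP hT hcard hy hx]

theorem IsFMTriangulation.finite_star (hK : P.IsFMTriangulation K) (hP : P.IsSaturated)
    (v : Plane) : {T ∈ K.faces | T.card = 3 ∧ v ∈ T}.Finite :=
  (hK.finite_triangles hP v 0).subset fun _ hT =>
    ⟨hT.1, hT.2.1, v, hT.2.2, (dist_self v).le⟩

/-- Only finitely many triangles come near `v`, and those without `v` as a vertex are closed sets
missing `v`, so they also miss a neighborhood. -/
theorem IsFMTriangulation.eventually_mem_star (hK : P.IsFMTriangulation K) (hP : P.IsSaturated)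
    {v : Plane} (hv : v ∈ K.vertices) :
    ∀ᶠ p in 𝓝 v, ∃ T ∈ K.faces, T.card = 3 ∧ v ∈ T ∧ p ∈ convexHull ℝ (T : Set Plane) := by
  -- The radius is `5 = 4 + 1`: a triangle meeting the unit ball around `v` has its vertices within
  -- `4` of the meeting point.
  have hfar : ∀ T ∈ {T ∈ K.faces | T.card = 3 ∧ ∃ x ∈ T, dist x v ≤ 5}, ∀ᶠ p in 𝓝 v,
      v ∉ T → p ∉ convexHull ℝ (T : Set Plane) := by
    rintro T ⟨hT, -, -⟩
    by_cases hvT : v ∈ T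
    · exact Eventually.of_forall fun p h => absurd hvT h
    · have hclosed : IsClosed (convexHull ℝ (T : Set Plane)) :=
        T.finite_toSet.isClosed_convexHull ℝ
      have hvc : v ∉ convexHull ℝ (T : Set Plane) :=
        fun h => hvT ((Geometry.SimplicialComplex.vertex_mem_convexHull_iff hv hT).1 h)
      filter_upwards [hclosed.isOpen_compl.mem_nhds hvc] with p hp _
      exact hp
  filter_upwards [(eventually_all_finite (hK.finite_triangles hP v 5)).2 hfar,
    Metric.ball_mem_nhds v one_pos] with p hp hpv
  obtain ⟨T, hT, hcard, hpT⟩ := hK.covers p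
  refine ⟨T, hT, hcard, ?_, hpT⟩
  by_contra hvT
  obtain ⟨x, hx⟩ := K.nonempty_of_mem_faces hT
  have hball : convexHull ℝ (T : Set Plane) ⊆ Metric.closedBall x 4 :=
    convexHull_min (fun y hy => Metric.mem_closedBall.2 (hK.dist_lt_four hP hT hcard hy hx).le)
      (convex_closedBall x 4)
  have h1 := Metric.mem_closedBall.1 (hball hpT)
  have h2 := Metric.mem_ball.1 hpv
  exact hp T ⟨hT, hcard, x, hx, by linarith [dist_triangle_left x v p]⟩ hvT hpT

/-- The potentials around a vertex of an FM-triangulation have a nonnegative sum. -/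
theorem IsFMTriangulation.finsum_vertexPotential_nonneg (hK : P.IsFMTriangulation K)
    (hP : P.IsSaturated) {m : Size → ℝ} (hm : ∀ q, minSlope q ≤ m q) {v : Plane}
    (hv : v ∈ K.vertices) :
    0 ≤ ∑ᶠ T ∈ {T ∈ K.faces | T.card = 3 ∧ v ∈ T}, P.vertexPotential m v T := by
  classical
  obtain ⟨N, next, hmaps, hinj, hnext, hbij, hsum⟩ :=
    exists_corona (hK.finite_star hP v) (hK.eventually_mem_star hP hv)
  have hpot : ∀ x ∈ N, P.cornerPotential m x v (next x) =
      P.vertexPotential m v {v, x, next x} := fun x hx => by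
    obtain ⟨nx, ny, nxy⟩ := ne_of_cross_sub_pos (hnext x hx).2
    exact (vertexPotential_eq P m nx ny nxy).symm
  rw [← finsum_mem_eq_of_bijOn _ hbij hpot, finsum_mem_coe_finset]
  have hcorona := corona_nonneg (size := P.size) hmaps hinj
    (fun x hx => (ne_of_cross_sub_pos (hnext x hx).2).2.2.symm) (P.size v)
  -- The triangle inequality: since the true angles sum to `2π`, the total deviation is at least the
  -- angular defect of the tight corona.
  have habs := abs_sum_le_sum_abs (fun x => EuclideanGeometry.angle x v (next x) -
    tightAngle (P.size x) (P.size v) (P.size (next x))) N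
  rw [sum_sub_distrib, hsum] at habs
  have hmul := mul_le_mul (hm (P.size v)) habs (abs_nonneg _) ((minSlope_nonneg _).trans (hm _))
  unfold cornerPotential
  rw [sum_add_distrib, ← mul_sum]
  linarith

end Packing

end

end TernaryPacking

theorem mainTheorem2 (m : TernaryPacking.Size → ℝ)
    (hm_one : 0.115610891330759 ≤ m .one)
    (hm_r : 0.023471932071104 ≤ m .r)
    (hm_s : 0.022750796636041 ≤ m .s)
    (P : TernaryPacking.Packing) (hP : P.IsSaturated)
    (K : Geometry.SimplicialComplex ℝ TernaryPacking.Plane) (hK : P.IsFMTriangulation K)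
    (v : TernaryPacking.Plane) (hv : v ∈ K.vertices) :
    {T ∈ K.faces | T.card = 3 ∧ v ∈ T}.Finite ∧
      0 ≤ ∑ᶠ T ∈ {T ∈ K.faces | T.card = 3 ∧ v ∈ T}, P.vertexPotential m v T := by
  refine ⟨hK.finite_star hP v, hK.finsum_vertexPotential_nonneg hP (fun q => ?_) hv⟩
  cases q
  · exact hm_one
  · exact hm_r
  · exact hm_s
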